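/- We work over $\mathbb{C}$; $\mathbb{P}(V)$ is the space of lines in $V$. For integers $m,r\ge 0$ and a sequence $\mathbf a=(a_0,\dots,a_r)$ of non-negative integers, let $S_m(\mathbf a)\subseteq\mathbb{P}^{N}$ be the image of the projective bundle $\mathbb{P}\big(\bigoplus_{i=0}^r\mathcal{O}_{\mathbb{P}^m}(-a_i)\big)$ (of lines in the fibres) under the morphism given by the complete linear system of its tautological line bundle $\mathcal{O}(1)$; explicitly, it is the set of points with homogeneous coordinates $(y_i\,x^{\mu})_{0\le i\le r,\ |\mu|=a_i}$, where $[x]\in\mathbb{P}^m$ and $0\neq y\in\mathbb{C}^{r+1}$. The dual variety of a projective variety $Z\subseteq\mathbb{P}(V)$ is the Zariski closure in $\mathbb{P}(V^*)$ of the set of hyperplanes tangent to $Z$ at some smooth point, and the codegree of $Z$ is the degree of its dual variety. **Proposition.** 1. Let $(1^r,2)=(1,\dots,1,2)$ with $r$ entries equal to $1$. If $m\ge r$, then the dual variety of $S_m(1^r,2)\subseteq\mathbb{P}^N$, $N=r(m+1)+\binom{m+2}{2}-1$, is an irreducible hypersurface of degree $m+r+1$, i.e. the zero locus of an irreducible homogeneous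 polynomial of degree $m+r+1$. (For $m=r=0$ this says that the dual variety is empty.) 2. Consequently, let $m\ge 2$, let $\omega$ be an alternating bilinear form of rank $2m$ on $\mathbb{C}^{2m+1}$, and let $X=X^3(m,m-1)$ be the odd Lagrangian Grassmannian of $m$-dimensional $\omega$-isotropic subspaces of $\mathbb{C}^{2m+1}$. For every $W\in X$ not containing $\ker\omega$ (such points form a dense open subset of $X$), let $\mathcal{C}_W\subseteq\mathbb{P}(T_WX)$ be the variety of minimal rational tangents at $W$, i.e. the Zariski closure of the set of tangent directions at $W$ of the non-constant rational curves on $X$ through $W$ that have minimal degree in the Plücker embedding. Then the dual variety of $\mathcal{C}_W$ is an irreducible hypersurface of degree $m+1$; that is, $\mathcal{C}_W$ has codegree $m+1$ (and dual defect $0$). -/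

import Mathlib

noncomputable section

open MvPolynomial
open scoped LinearAlgebra.Projectivization Matrix

namespace ScrollDual

/-! ### Projective subvarieties of `ℙ(ℂ^ι)` and their dual varieties -/

section Projective

variable {ι : Type} [Fintype ι]

/-- The punctured affine cone over a set of points of projective space. -/
def cone (Z : Set (ℙ ℂ (ι → ℂ))) : Set (ι → ℂ) :=
  {v | ∃ h : v ≠ 0, Projectivization.mk ℂ v h ∈ Z}

/-- The ideal of `Z` (polynomials vanishing on the cone; it is a homogeneous radical ideal). -/
def projIdeal (Z : Set (ℙ ℂ (ι → ℂ))) : Ideal (MvPolynomial ι ℂ) :=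
  vanishingIdeal ℂ (cone Z)

/-- The Zariski closure of a set of points of projective space. -/
def zariskiClosure (A : Set (ℙ ℂ (ι → ℂ))) : Set (ℙ ℂ (ι → ℂ)) :=
  {p | ∀ (d : ℕ) (F : MvPolynomial ι ℂ), F.IsHomogeneous d →
    (∀ q ∈ A, eval q.rep F = 0) → eval p.rep F = 0}

/-- The differential of the polynomial function `F` at the vector `v`. -/
def differential (v : ι → ℂ) (F : MvPolynomial ι ℂ) : (ι → ℂ) →ₗ[ℂ] ℂ :=
  ∑ i, eval v (pderiv i F) • LinearMap.proj i

/-- The (linear subspace of `ℂ^ι` underlying the) embedded projective tangent space of `Z` at `p`: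
the common kernel of the differentials at `p` of all equations of `Z`. -/
def embeddedTangentSpace (Z : Set (ℙ ℂ (ι → ℂ))) (p : ℙ ℂ (ι → ℂ)) : Submodule ℂ (ι → ℂ) :=
  ⨅ F ∈ projIdeal Z, LinearMap.ker (differential p.rep F)

/-- `p` is a smooth point of the closed subvariety `Z` (Jacobian criterion): in a Zariski
neighbourhood `{G ≠ 0}` of `p`, the variety `Z` is cut out by equations
`F₁ = ⋯ = F_c = 0` of `Z` whose differentials at `p` are linearly independent. -/
def IsSmoothPoint (Z : Set (ℙ ℂ (ι → ℂ))) (p : ℙ ℂ (ι → ℂ)) : Prop :=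
  p ∈ Z ∧ ∃ (c : ℕ) (F : Fin c → MvPolynomial ι ℂ) (G : MvPolynomial ι ℂ),
    (∀ k, F k ∈ projIdeal Z) ∧
    LinearIndependent ℂ (fun k => differential p.rep (F k)) ∧
    eval p.rep G ≠ 0 ∧
    ∀ v : ι → ℂ, eval v G ≠ 0 → (∀ k, eval v (F k) = 0) → v ∈ cone Z

/-- The dual variety of `Z`: the Zariski closure of the set of hyperplanes tangent to `Z` at some
smooth point. The dual projective space is identified with `ℙ(ℂ^ι)` by the dual coordinates:
`H = [h]` is the hyperplane `∑ i, h i * w i = 0`. -/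
def dualVariety (Z : Set (ℙ ℂ (ι → ℂ))) : Set (ℙ ℂ (ι → ℂ)) :=
  zariskiClosure {H | ∃ p, IsSmoothPoint Z p ∧ ∀ w ∈ embeddedTangentSpace Z p, H.rep ⬝ᵥ w = 0}

/-- `Y` is an irreducible (reduced) hypersurface of degree `d`: the zero locus of an
irreducible homogeneous polynomial of degree `d`. -/
def IsIrreducibleHypersurface (Y : Set (ℙ ℂ (ι → ℂ))) (d : ℕ) : Prop :=
  ∃ F : MvPolynomial ι ℂ, Irreducible F ∧ F.IsHomogeneous d ∧ Y = {p | eval p.rep F = 0}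

end Projective

/-! ### Scrolls -/

/-- Indices of the homogeneous coordinates of `ℙ^{N(m,a)}`: a basis of
`H⁰(ℙ(E_m(a)), 𝒪(1)) = ⨁ᵢ H⁰(ℙ^m, 𝒪(aᵢ))` is given by the pairs of an index `i ≤ r` and a monomial
of degree `aᵢ` in `m + 1` variables (a multiset of `aᵢ` variables). -/
abbrev ScrollIndex (m : ℕ) {r : ℕ} (a : Fin (r + 1) → ℕ) : Type :=
  Σ i : Fin (r + 1), Sym (Fin (m + 1)) (a i)

/-- Coordinates of the image under the tautological morphism of the point of `ℙ(E_m(a))` lying over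
`[x] ∈ ℙ^m`, in the fibre direction `(yᵢ x^{⊗ aᵢ})ᵢ ∈ ⨁ᵢ 𝒪(-aᵢ)_{[x]}`. -/
def scrollMap (m : ℕ) {r : ℕ} (a : Fin (r + 1) → ℕ)
    (x : Fin (m + 1) → ℂ) (y : Fin (r + 1) → ℂ) : ScrollIndex m a → ℂ :=
  fun c => y c.1 * ((c.2 : Multiset (Fin (m + 1))).map x).prod

/-- The scroll `S_m(a)`: the image of `ℙ(⨁ᵢ 𝒪_{ℙ^m}(-aᵢ))` (lines in the fibres) under the
morphism given by the complete linear system of the tautological line bundle. -/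
def scroll (m : ℕ) {r : ℕ} (a : Fin (r + 1) → ℕ) : Set (ℙ ℂ (ScrollIndex m a → ℂ)) :=
  {p | ∃ (x : Fin (m + 1) → ℂ) (y : Fin (r + 1) → ℂ) (h : scrollMap m a x y ≠ 0),
    x ≠ 0 ∧ p = Projectivization.mk ℂ (scrollMap m a x y) h}

/-- The sequence `(1^r, 2) = (1, …, 1, 2)` with `r` entries equal to `1`. -/
def onesTwo (r : ℕ) : Fin (r + 1) → ℕ :=
  Fin.snoc (α := fun _ => ℕ) (fun _ : Fin r => 1) 2

/-! ### Isotropic Grassmannians and their varieties of minimal rational tangents -/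

section Isotropic

variable {k n : ℕ}

/-- The Grassmannian of `k`-dimensional subspaces of `ℂ^n` that are isotropic for the bilinear form
with matrix `Ω`. For `Ω` alternating of rank `2m` and `n = 2m + 1`, this is an odd symplectic
Grassmannian; for moreover `k = m`, it is the odd Lagrangian Grassmannian `X³(m, m-1)`. -/
def isotropicGrassmannian (k : ℕ) (Ω : Matrix (Fin n) (Fin n) ℂ) :
    Set (Submodule ℂ (Fin n → ℂ)) :=
  {W | Module.finrank ℂ W = k ∧ ∀ u ∈ W, ∀ v ∈ W, u ⬝ᵥ (Ω *ᵥ v) = 0}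

/-- Linear maps `ψ : W → ℂ^n` such that `id + εψ` is isotropic over the dual numbers. -/
def firstOrderDeformations (Ω : Matrix (Fin n) (Fin n) ℂ) (W : Submodule ℂ (Fin n → ℂ)) :
    Submodule ℂ (W →ₗ[ℂ] (Fin n → ℂ)) where
  carrier := {ψ | ∀ w w' : W, ψ w ⬝ᵥ (Ω *ᵥ w') + w ⬝ᵥ (Ω *ᵥ ψ w') = 0}
  zero_mem' := by intro w w'; simp
  add_mem' := by
    intro ψ ψ' h h' w w'
    have e := h w w'
    have e' := h' w w'
    simp only [LinearMap.add_apply, add_dotProduct, Matrix.mulVec_add, dotProduct_add]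
    linear_combination e + e'
  smul_mem' := by
    intro c ψ h w w'
    have e := h w w'
    simp only [LinearMap.smul_apply, smul_dotProduct, Matrix.mulVec_smul, dotProduct_smul,
      smul_eq_mul]
    linear_combination c * e

/-- The tangent space at `W` of the isotropic Grassmannian, as a subspace of the tangent space
`Hom(W, ℂ^n / W)` of the Grassmannian. -/
def grassmannianTangentSpace (Ω : Matrix (Fin n) (Fin n) ℂ) (W : Submodule ℂ (Fin n → ℂ)) :
    Submodule ℂ (W →ₗ[ℂ] ((Fin n → ℂ) ⧸ W)) :=
  (firstOrderDeformations Ω W).map (LinearMap.compRight ℂ W.mkQ)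

/-- The subspace spanned by the rows at the parameter `s` of a matrix of polynomials. -/
def curvePoint (M : Matrix (Fin k) (Fin n) (Polynomial ℂ)) (s : ℂ) : Submodule ℂ (Fin n → ℂ) :=
  Submodule.span ℂ (Set.range fun i => fun j => (M i j).eval s)

/-- `M` parametrises a rational curve on the isotropic Grassmannian passing through `W` at the
parameter `0`. Every morphism from `ℙ¹` to a Grassmannian is of this form on the affine line
(vector bundles on the affine line are trivial), and each such map on the affine line extends
uniquely to `ℙ¹`. -/
def IsRationalCurveThrough (Ω : Matrix (Fin n) (Fin n) ℂ) (W : Submodule ℂ (Fin n → ℂ))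
    (M : Matrix (Fin k) (Fin n) (Polynomial ℂ)) : Prop :=
  (∀ s : ℂ, curvePoint M s ∈ isotropicGrassmannian k Ω) ∧ curvePoint M 0 = W

/-- The degree of a parametrised rational curve with respect to the Plücker line bundle: the
maximal degree of the `k × k` minors, which have no common zero on the affine line. -/
def pluckerDegree (M : Matrix (Fin k) (Fin n) (Polynomial ℂ)) : ℕ :=
  Finset.univ.sup fun e : Fin k → Fin n => (M.submatrix id e).det.natDegree

/-- `M` parametrises a minimal rational curve through `W`: a nonconstant rational curve through `W`
of the least possible degree. -/
def IsMinimalRationalCurveThrough (Ω : Matrix (Fin n) (Fin n) ℂ) (W : Submodule ℂ (Fin n → ℂ))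
    (M : Matrix (Fin k) (Fin n) (Polynomial ℂ)) : Prop :=
  IsRationalCurveThrough Ω W M ∧ 0 < pluckerDegree M ∧
    ∀ M' : Matrix (Fin k) (Fin n) (Polynomial ℂ),
      IsRationalCurveThrough Ω W M' → 0 < pluckerDegree M' → pluckerDegree M ≤ pluckerDegree M'

/-- `φ : W → ℂ^n / W` is the velocity at the parameter `0` of the curve parametrised by `M`: it
sends the value at `0` of each row to the derivative at `0` of that row, modulo `W`. -/
def IsVelocity (W : Submodule ℂ (Fin n → ℂ)) (M : Matrix (Fin k) (Fin n) (Polynomial ℂ))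
    (φ : W →ₗ[ℂ] ((Fin n → ℂ) ⧸ W)) : Prop :=
  ∀ (i : Fin k) (w : W), (w : Fin n → ℂ) = (fun j => (M i j).eval 0) →
    φ w = W.mkQ (fun j => (M i j).derivative.eval 0)

/-- The tangent directions at `W` of the minimal rational curves through `W` on the Grassmannian
of isotropic `k`-dimensional subspaces. -/
def minimalRationalTangents (k : ℕ) (Ω : Matrix (Fin n) (Fin n) ℂ)
    (W : Submodule ℂ (Fin n → ℂ)) : Set (ℙ ℂ (grassmannianTangentSpace Ω W)) :=
  {p | ∃ (M : Matrix (Fin k) (Fin n) (Polynomial ℂ)) (φ : grassmannianTangentSpace Ω W)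
      (h : φ ≠ 0), IsMinimalRationalCurveThrough Ω W M ∧ IsVelocity W M φ.1 ∧
      p = Projectivization.mk ℂ φ h}

/-- The variety of minimal rational tangents at `W`, the Zariski closure of the set of tangent
directions of minimal rational curves, in the homogeneous coordinates on the projectivised tangent
space given by a basis `b` of the tangent space. -/
def vmrt (k : ℕ) (Ω : Matrix (Fin n) (Fin n) ℂ) (W : Submodule ℂ (Fin n → ℂ))
    {d : ℕ} (b : Module.Basis (Fin d) ℂ (grassmannianTangentSpace Ω W)) :
    Set (ℙ ℂ (Fin d → ℂ)) :=
  zariskiClosure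
    (Projectivization.map b.equivFun.toLinearMap b.equivFun.injective ''
      minimalRationalTangents k Ω W)

end Isotropic

end ScrollDual

end

open MvPolynomial
open scoped LinearAlgebra.Projectivization Matrix

namespace ScrollDual

set_option linter.unusedSectionVars false

/-! ### Affine cones, smooth vectors and conormal vectors under linear changes of coordinates. -/

section ConeTheory

variable {ι κ : Type} [Fintype ι] [Fintype κ]

/-! Put `n = m + 1`. A linear form `h` on the space containing `S_m(1^r, 2)` is a pair of a bilinear
form `b` on `ℂ^r × ℂ^n` and a quadratic form `q` on `ℂ^n`, and it restricts to `b(y, x) + t q(x)` on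
the scroll. Tangency at the point with parameters `(y, t, x)` forces the Hessian `[[M, Bᵀ], [B, 0]]`
of `q(x) + b(y, x)` to kill `(t x, y)` (`dotProduct_scrollVelocity`). Conversely, a kernel vector
`(x, y)` with `x ≠ 0` makes `h` tangent at the point `(y, 1, x)`, which is smooth and whose tangent
space consists of velocities of the parametrisation (`mem_conormal_of_mulVec_eq_zero`). So the dual
variety should be the locus where this determinant, of degree `n + r`, vanishes.

Two points remain. A degenerate `h` may have only kernel vectors `(0, y)`; then `B` drops rank, `ker
B` has dimension at least 2 because `r < n`, so it contains a vector isotropic for `M`, and this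
allows `h` to be moved along a line of conormal vectors that tends to `h`
(`eval_eq_zero_of_det_borderedMatrix_eq_zero`). The determinant is irreducible because it
specialises, up to sign and without loss of degree, to the Eisenstein polynomial `T^(n+r) - z`
(`irreducible_borderedDet`).

For the odd Lagrangian Grassmannian, if `W` meets `ker ω` trivially then `ω` and one further linear
form identify `ℂ^(2m+1) / W` with `ℂ ⊕ W*`, and the tangent space with `W* ⊕ Sym² W*`. Lines exist,
so minimal curves have Plücker degree one, and their velocities are exactly the tangent vectors of
rank one (`mk_mem_minimalRationalTangents_iff`). In these coordinates they are the vectors `(y x, t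
x²)`, the cone over a scroll of type `(1, 2)` over `ℙ^(m-1)` (`exists_cone_vmrt_eq`). The
determinant criterion with `n = m`, `r = 1` gives degree `m + 1`. -/

lemma mem_vanishingIdeal_iff_eval {C : Set (ι → ℂ)} {F : MvPolynomial ι ℂ} :
    F ∈ vanishingIdeal ℂ C ↔ ∀ v ∈ C, eval v F = 0 := by
  simp only [mem_vanishingIdeal_iff, aeval_eq_eval]

lemma differential_apply (v : ι → ℂ) (F : MvPolynomial ι ℂ) (w : ι → ℂ) :
    differential v F w = ∑ i, eval v (pderiv i F) * w i := by
  simp [differential]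

@[simp] lemma differential_C (v : ι → ℂ) (a : ℂ) (w : ι → ℂ) :
    differential v (C a) w = 0 := by simp [differential_apply]

lemma differential_add (v : ι → ℂ) (F G : MvPolynomial ι ℂ) (w : ι → ℂ) :
    differential v (F + G) w = differential v F w + differential v G w := by
  simp [differential_apply, add_mul, Finset.sum_add_distrib]

lemma differential_sub (v : ι → ℂ) (F G : MvPolynomial ι ℂ) (w : ι → ℂ) :
    differential v (F - G) w = differential v F w - differential v G w := by
  simp [differential_apply, sub_mul, Finset.sum_sub_distrib]

lemma differential_mul (v : ι → ℂ) (F G : MvPolynomial ι ℂ) (w : ι → ℂ) :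
    differential v (F * G) w =
      differential v F w * eval v G + eval v F * differential v G w := by
  simp only [differential_apply, Derivation.leibniz, smul_eq_mul, map_add, map_mul, Finset.sum_mul,
    Finset.mul_sum, ← Finset.sum_add_distrib]
  exact Finset.sum_congr rfl fun i _ => by ring

@[simp] lemma differential_X (v : ι → ℂ) (i : ι) (w : ι → ℂ) :
    differential v (X i) w = w i := by
  classical
  simp only [differential_apply, pderiv_X]
  rw [Finset.sum_eq_single i] <;> simp +contextual [eq_comm]

lemma eval_aeval_curve (γ : ι → Polynomial ℂ) (F : MvPolynomial ι ℂ) (s : ℂ) :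
    (aeval γ F).eval s = eval (fun i => (γ i).eval s) F := by
  induction F using MvPolynomial.induction_on with
  | C a => simp
  | add p q hp hq => simp [hp, hq]
  | mul_X p i hp => simp [hp]

/-- The velocity at `0` of the composition of a polynomial with a polynomial curve. -/
lemma eval_derivative_aeval (γ : ι → Polynomial ℂ) (F : MvPolynomial ι ℂ) :
    (aeval γ F).derivative.eval 0 =
      differential (fun i => (γ i).eval 0) F (fun i => (γ i).derivative.eval 0) := by
  induction F using MvPolynomial.induction_on with
  | C a => simp
  | add p q hp hq => simp [hp, hq, differential_add]
  | mul_X p i hp => simp [hp, differential_mul, eval_aeval_curve]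

/-- A polynomial curve which lies in `C` wherever it does not vanish has its velocity in the
tangent space of `C`. -/
lemma differential_velocity_eq_zero {C : Set (ι → ℂ)} (γ : ι → Polynomial ℂ)
    (hγ : ∀ s : ℂ, (fun i => (γ i).eval s) ≠ 0 → (fun i => (γ i).eval s) ∈ C)
    (h0 : (fun i => (γ i).eval 0) ≠ 0) {F : MvPolynomial ι ℂ} (hF : F ∈ vanishingIdeal ℂ C) :
    differential (fun i => (γ i).eval 0) F (fun i => (γ i).derivative.eval 0) = 0 := by
  rw [mem_vanishingIdeal_iff_eval] at hF
  obtain ⟨i, hi⟩ := Function.ne_iff.1 h0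
  -- The cone is punctured, so `F` is known to vanish only where the curve is nonzero; the factor `γ
  -- i` covers the parameters at which the curve passes through the origin.
  have hprod : aeval γ F * γ i = 0 := by
    refine Polynomial.funext fun s => ?_
    rw [Polynomial.eval_mul, Polynomial.eval_zero, eval_aeval_curve]
    by_cases hs : (fun i => (γ i).eval s) = 0
    · rw [show (γ i).eval s = 0 from congrFun hs i, mul_zero]
    · rw [hF _ (hγ s hs), zero_mul]
  have hne : γ i ≠ 0 := fun h => hi (by simp [h])
  rw [← eval_derivative_aeval, (mul_eq_zero.1 hprod).resolve_right hne]
  simp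

lemma IsHomogeneous.eval_smul_eq {F : MvPolynomial ι ℂ} {d : ℕ} (hF : F.IsHomogeneous d) (c : ℂ)
    (v : ι → ℂ) : eval (c • v) F = c ^ d * eval v F := by
  rw [eval_eq', eval_eq', Finset.mul_sum]
  refine Finset.sum_congr rfl fun e he => ?_
  have hd : ∑ i, e i = d := by
    have := hF (mem_support_iff.1 he)
    rw [← this, Finsupp.weight_apply, Finsupp.sum_fintype] <;> simp
  simp only [Pi.smul_apply, smul_eq_mul, mul_pow, Finset.prod_mul_distrib, Finset.prod_pow_eq_pow_sum,
    hd]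
  ring

/-- The composition of a polynomial with a linear map. -/
noncomputable def pull (L : (ι → ℂ) →ₗ[ℂ] (κ → ℂ)) : MvPolynomial κ ℂ →ₐ[ℂ] MvPolynomial ι ℂ :=
  haveI := Classical.decEq ι
  aeval fun k => ∑ i, C (L (Pi.single i 1) k) * X i

lemma eval_pull_X (L : (ι → ℂ) →ₗ[ℂ] (κ → ℂ)) (v : ι → ℂ) (k : κ) :
    eval v (pull L (X k)) = L v k := by
  classical
  conv_rhs => rw [LinearMap.pi_apply_eq_sum_univ L v]
  simp only [pull, aeval_X, map_sum, map_mul, eval_C, eval_X, Finset.sum_apply, Pi.smul_apply,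
    smul_eq_mul]
  refine Finset.sum_congr rfl fun i _ => ?_
  rw [mul_comm]
  have : (Pi.single i 1 : ι → ℂ) = fun j => if i = j then 1 else 0 := by
    ext j
    simp [Pi.single_apply, eq_comm]
  rw [← this]

lemma eval_pull (L : (ι → ℂ) →ₗ[ℂ] (κ → ℂ)) (v : ι → ℂ) (F : MvPolynomial κ ℂ) :
    eval v (pull L F) = eval (L v) F := by
  induction F using MvPolynomial.induction_on with
  | C a => simp [pull]
  | add p q hp hq => simp [hp, hq]
  | mul_X p k hp => rw [map_mul, map_mul, hp, eval_pull_X, map_mul, eval_X]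

lemma differential_pull_X (L : (ι → ℂ) →ₗ[ℂ] (κ → ℂ)) (v w : ι → ℂ) (k : κ) :
    differential v (pull L (X k)) w = L w k := by
  rw [← eval_pull_X, differential_apply]
  simp only [pull, aeval_X, map_sum, Derivation.leibniz, map_mul, eval_X, eval_C]
  refine Finset.sum_congr rfl fun i _ => ?_
  classical
  rw [Finset.sum_eq_single i]
  · simp
  · intro j _ hj
    simp [pderiv_X, hj]
  · simp

lemma differential_pull (L : (ι → ℂ) →ₗ[ℂ] (κ → ℂ)) (v w : ι → ℂ) (F : MvPolynomial κ ℂ) :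
    differential v (pull L F) w = differential (L v) F (L w) := by
  induction F using MvPolynomial.induction_on with
  | C a => simp [pull]
  | add p q hp hq => simp [hp, hq, differential_add]
  | mul_X p k hp =>
    rw [map_mul, differential_mul, hp, differential_mul, eval_pull, eval_pull, differential_X,
      differential_pull_X]

lemma pull_isHomogeneous (L : (ι → ℂ) →ₗ[ℂ] (κ → ℂ)) {F : MvPolynomial κ ℂ} {d : ℕ}
    (hF : F.IsHomogeneous d) : (pull L F).IsHomogeneous d := by
  have := hF.aeval (n := 1) (fun k => ∑ i, (C (L (haveI := Classical.decEq ι; Pi.single i 1) k) *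
    X i : MvPolynomial ι ℂ)) fun k => IsHomogeneous.sum _ _ _ fun i _ => isHomogeneous_C_mul_X _ _
  rwa [one_mul] at this

/-- The isomorphism of polynomial rings given by a linear change of coordinates. -/
noncomputable def pullEquiv (L : (ι → ℂ) ≃ₗ[ℂ] (κ → ℂ)) : MvPolynomial κ ℂ ≃ₐ[ℂ] MvPolynomial ι ℂ :=
  AlgEquiv.ofAlgHom (pull L.toLinearMap) (pull L.symm.toLinearMap)
    (AlgHom.ext fun F => MvPolynomial.funext fun v => by simp [eval_pull])
    (AlgHom.ext fun F => MvPolynomial.funext fun v => by simp [eval_pull])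

lemma irreducible_pull (L : (ι → ℂ) ≃ₗ[ℂ] (κ → ℂ)) {F : MvPolynomial κ ℂ} (hF : Irreducible F) :
    Irreducible (pull L.toLinearMap F) :=
  (MulEquiv.irreducible_iff (pullEquiv L)).2 hF

/-- The Jacobian criterion for smoothness of the cone `C` at the vector `v`. -/
def IsSmoothVector (C : Set (ι → ℂ)) (v : ι → ℂ) : Prop :=
  v ∈ C ∧ ∃ (c : ℕ) (F : Fin c → MvPolynomial ι ℂ) (G : MvPolynomial ι ℂ),
    (∀ k, F k ∈ vanishingIdeal ℂ C) ∧
    LinearIndependent ℂ (fun k => differential v (F k)) ∧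
    eval v G ≠ 0 ∧
    ∀ w : ι → ℂ, eval w G ≠ 0 → (∀ k, eval w (F k) = 0) → w ∈ C

/-- The coordinate vectors of linear forms which vanish on a tangent space of `C` at a smooth
vector. -/
def conormal (C : Set (ι → ℂ)) : Set (ι → ℂ) :=
  {h | ∃ v, IsSmoothVector C v ∧
    ∀ w, (∀ F ∈ vanishingIdeal ℂ C, differential v F w = 0) → h ⬝ᵥ w = 0}

lemma pull_mem_vanishingIdeal (L : (ι → ℂ) ≃ₗ[ℂ] (κ → ℂ)) {C : Set (ι → ℂ)}
    {F : MvPolynomial κ ℂ} :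
    pull L.toLinearMap F ∈ vanishingIdeal ℂ C ↔ F ∈ vanishingIdeal ℂ (L '' C) := by
  simp [eval_pull]

lemma pull_pull_symm (L : (ι → ℂ) ≃ₗ[ℂ] (κ → ℂ)) (F : MvPolynomial ι ℂ) :
    pull L.toLinearMap (pull L.symm.toLinearMap F) = F :=
  MvPolynomial.funext fun v => by simp [eval_pull]

lemma IsSmoothVector.image (L : (ι → ℂ) ≃ₗ[ℂ] (κ → ℂ)) {C : Set (ι → ℂ)} {v : ι → ℂ}
    (h : IsSmoothVector C v) : IsSmoothVector (L '' C) (L v) := by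
  obtain ⟨hv, c, F, G, hF, hli, hG, hcut⟩ := h
  refine ⟨⟨v, hv, rfl⟩, c, fun k => pull L.symm.toLinearMap (F k), pull L.symm.toLinearMap G,
    fun k => ?_, ?_, by simpa [eval_pull] using hG, fun w hw hFw => ?_⟩
  · rw [← pull_mem_vanishingIdeal, pull_pull_symm]
    exact hF k
  · have := hli.map' (L.symm.toLinearMap.lcomp ℂ ℂ) <| LinearMap.ker_eq_bot.2 fun f g hfg => by
      refine LinearMap.ext fun w => ?_
      simpa using LinearMap.congr_fun hfg (L w)
    have heq : (fun k => differential (L v) (pull L.symm.toLinearMap (F k))) =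
        L.symm.toLinearMap.lcomp ℂ ℂ ∘ fun k => differential v (F k) := by
      funext k
      refine LinearMap.ext fun w => ?_
      simp [differential_pull]
    rw [heq]
    exact this
  · refine ⟨L.symm w, hcut _ (by simpa [eval_pull] using hw) fun k => ?_, by simp⟩
    simpa [eval_pull] using hFw k

/-- The transpose of a linear equivalence, in coordinates. -/
noncomputable def transposeEquiv (L : (ι → ℂ) ≃ₗ[ℂ] (κ → ℂ)) : (κ → ℂ) ≃ₗ[ℂ] (ι → ℂ) :=
  haveI := Classical.decEq ι
  haveI := Classical.decEq κ
  LinearEquiv.ofLinearMap (LinearMap.toMatrix' L.toLinearMap)ᵀ.mulVecLin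
    (LinearMap.toMatrix' L.symm.toLinearMap)ᵀ.mulVecLin
    (by rw [← Matrix.mulVecLin_mul, ← Matrix.transpose_mul, ← LinearMap.toMatrix'_comp]; simp)
    (by rw [← Matrix.mulVecLin_mul, ← Matrix.transpose_mul, ← LinearMap.toMatrix'_comp]; simp)

lemma transposeEquiv_dotProduct (L : (ι → ℂ) ≃ₗ[ℂ] (κ → ℂ)) (h : κ → ℂ) (w : ι → ℂ) :
    transposeEquiv L h ⬝ᵥ w = h ⬝ᵥ L w := by
  classical
  have : L w = (LinearMap.toMatrix' L.toLinearMap) *ᵥ w := by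
    rw [← Matrix.toLin'_apply, Matrix.toLin'_toMatrix']; rfl
  rw [this, Matrix.dotProduct_mulVec, ← Matrix.mulVec_transpose]
  simp only [transposeEquiv, LinearEquiv.coe_ofLinearMap, Matrix.mulVecLin_apply]

lemma transposeEquiv_mem_conormal (L : (ι → ℂ) ≃ₗ[ℂ] (κ → ℂ)) {C : Set (ι → ℂ)} {h : κ → ℂ}
    (hh : h ∈ conormal (L '' C)) : transposeEquiv L h ∈ conormal C := by
  obtain ⟨v, hv, hw⟩ := hh
  refine ⟨L.symm v, ?_, fun w hFw => ?_⟩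
  · have := hv.image L.symm
    rwa [← Set.image_comp, show ⇑L.symm ∘ ⇑L = id from funext L.symm_apply_apply,
      Set.image_id] at this
  · rw [transposeEquiv_dotProduct]
    refine hw _ fun F hF => ?_
    have := hFw _ ((pull_mem_vanishingIdeal L).2 hF)
    simpa [differential_pull] using this

lemma transposeEquiv_mem_conormal_iff (L : (ι → ℂ) ≃ₗ[ℂ] (κ → ℂ)) {C : Set (ι → ℂ)} {h : κ → ℂ} :
    transposeEquiv L h ∈ conormal C ↔ h ∈ conormal (L '' C) := by
  refine ⟨fun hh => ?_, transposeEquiv_mem_conormal L⟩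
  have := transposeEquiv_mem_conormal L.symm (C := L '' C) (h := transposeEquiv L h)
    (by rwa [← Set.image_comp, show ⇑L.symm ∘ ⇑L = id from funext L.symm_apply_apply,
      Set.image_id])
  convert this
  refine dotProduct_eq _ _ fun w => ?_
  rw [transposeEquiv_dotProduct, transposeEquiv_dotProduct, L.apply_symm_apply]

lemma smul_mem_cone {Z : Set (ℙ ℂ (ι → ℂ))} {v : ι → ℂ} (c : ℂˣ) (hv : v ∈ cone Z) :
    (c : ℂ) • v ∈ cone Z := by
  obtain ⟨h, hv⟩ := hv
  have hc : (c : ℂ) • v ≠ 0 := smul_ne_zero c.ne_zero h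
  refine ⟨hc, ?_⟩
  rwa [(Projectivization.mk_eq_mk_iff ℂ _ _ hc h).2 ⟨c, rfl⟩]

lemma IsSmoothVector.smul {Z : Set (ℙ ℂ (ι → ℂ))} {v : ι → ℂ} (c : ℂˣ)
    (hv : IsSmoothVector (cone Z) v) : IsSmoothVector (cone Z) ((c : ℂ) • v) := by
  have := hv.image (LinearEquiv.smulOfUnit c : (ι → ℂ) ≃ₗ[ℂ] (ι → ℂ))
  have himage : (LinearEquiv.smulOfUnit c : (ι → ℂ) ≃ₗ[ℂ] (ι → ℂ)) '' cone Z = cone Z := by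
    ext w
    refine ⟨?_, fun hw => ⟨(c⁻¹ : ℂˣ) • w, smul_mem_cone c⁻¹ hw, smul_inv_smul c w⟩⟩
    rintro ⟨u, hu, rfl⟩
    exact smul_mem_cone c hu
  rwa [himage] at this

/-- Precomposing an equation with the scaling by `c⁻¹` gives another equation of the cone. Hence
tangency does not depend on the representative `rep` used in `embeddedTangentSpace`. -/
lemma tangent_smul {Z : Set (ℙ ℂ (ι → ℂ))} {v w : ι → ℂ} (c : ℂˣ)
    (hw : ∀ F ∈ vanishingIdeal ℂ (cone Z), differential ((c : ℂ) • v) F w = 0) :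
    ∀ F ∈ vanishingIdeal ℂ (cone Z), differential v F w = 0 := by
  intro F hF
  let L : (ι → ℂ) →ₗ[ℂ] (ι → ℂ) := ((c⁻¹ : ℂˣ) : ℂ) • LinearMap.id
  have hL : pull L F ∈ vanishingIdeal ℂ (cone Z) := by
    rw [mem_vanishingIdeal_iff_eval] at hF ⊢
    intro u hu
    rw [eval_pull]
    exact hF _ (smul_mem_cone c⁻¹ hu)
  have := hw _ hL
  rw [differential_pull] at this
  simpa [L] using this

lemma mem_embeddedTangentSpace {Z : Set (ℙ ℂ (ι → ℂ))} {p : ℙ ℂ (ι → ℂ)} {w : ι → ℂ} :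
    w ∈ embeddedTangentSpace Z p ↔
      ∀ F ∈ vanishingIdeal ℂ (cone Z), differential p.rep F w = 0 := by
  simp [embeddedTangentSpace, projIdeal]

lemma rep_mem_cone {Z : Set (ℙ ℂ (ι → ℂ))} {p : ℙ ℂ (ι → ℂ)} : p.rep ∈ cone Z ↔ p ∈ Z := by
  simp [cone, p.rep_nonzero, Projectivization.mk_rep]

lemma isSmoothPoint_iff {Z : Set (ℙ ℂ (ι → ℂ))} {p : ℙ ℂ (ι → ℂ)} :
    IsSmoothPoint Z p ↔ IsSmoothVector (cone Z) p.rep := by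
  simp [IsSmoothPoint, IsSmoothVector, rep_mem_cone, projIdeal]

lemma rep_mem_conormal_iff {Z : Set (ℙ ℂ (ι → ℂ))} {H : ℙ ℂ (ι → ℂ)} :
    H.rep ∈ conormal (cone Z) ↔
      ∃ p, IsSmoothPoint Z p ∧ ∀ w ∈ embeddedTangentSpace Z p, H.rep ⬝ᵥ w = 0 := by
  constructor
  · rintro ⟨v, hv, hw⟩
    obtain ⟨hv0, -⟩ := hv.1
    obtain ⟨c, hc⟩ := Projectivization.exists_smul_eq_mk_rep ℂ v hv0
    refine ⟨Projectivization.mk ℂ v hv0, ?_, fun w hFw => hw w ?_⟩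
    · rw [isSmoothPoint_iff, ← hc]
      exact hv.smul c
    · rw [mem_embeddedTangentSpace, ← hc] at hFw
      exact tangent_smul c hFw
  · rintro ⟨p, hp, hw⟩
    exact ⟨p.rep, isSmoothPoint_iff.1 hp, fun w hFw => hw w (mem_embeddedTangentSpace.2 hFw)⟩

lemma smul_mem_conormal {C : Set (ι → ℂ)} {h : ι → ℂ} (c : ℂ) (hh : h ∈ conormal C) :
    c • h ∈ conormal C := by
  obtain ⟨v, hv, hw⟩ := hh
  exact ⟨v, hv, fun w hFw => by rw [smul_dotProduct, hw w hFw, smul_zero]⟩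

/-- If the conormal vectors of the cone over `Z` are dense in the zero locus of an irreducible
form, then the dual variety of `Z` is an irreducible hypersurface. -/
theorem isIrreducibleHypersurface_dualVariety {Z : Set (ℙ ℂ (ι → ℂ))} {C : Set (κ → ℂ)}
    (L : (κ → ℂ) ≃ₗ[ℂ] (ι → ℂ)) (hZ : cone Z = L '' C) {d : ℕ} {P : MvPolynomial κ ℂ}
    (hP : Irreducible P) (hd : P.IsHomogeneous d)
    (hvanish : ∀ h ∈ conormal C, eval h P = 0)
    (hdense : ∀ h : κ → ℂ, h ≠ 0 → eval h P = 0 → ∀ (e : ℕ) (F : MvPolynomial κ ℂ),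
      F.IsHomogeneous e → (∀ h' ∈ conormal C, h' ≠ 0 → eval h' F = 0) → eval h F = 0) :
    IsIrreducibleHypersurface (dualVariety Z) d := by
  refine ⟨pull (transposeEquiv L).toLinearMap P, irreducible_pull _ hP, pull_isHomogeneous _ hd, ?_⟩
  ext H
  simp only [dualVariety, zariskiClosure, Set.mem_ofPred_eq, ← rep_mem_conormal_iff]
  rw [hZ]
  simp only [← transposeEquiv_mem_conormal_iff]
  constructor
  · intro hH
    refine hH d _ (pull_isHomogeneous _ hd) fun q hq => ?_
    rw [eval_pull]
    exact hvanish _ hq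
  · intro hH e F hF hvan
    have key := hdense (transposeEquiv L H.rep) (by simpa using H.rep_nonzero)
      (by rw [eval_pull] at hH; exact hH) e (pull (transposeEquiv L).symm.toLinearMap F)
      (pull_isHomogeneous _ hF) fun h' hh' hne => ?_
    · simpa [eval_pull] using key
    · have hne' : (transposeEquiv L).symm h' ≠ 0 := by simpa using hne
      -- The hypothesis on `F` concerns only the chosen representatives of projective points;
      -- homogeneity of `F` carries the vanishing to every nonzero conormal vector.
      obtain ⟨c, hc⟩ := Projectivization.exists_smul_eq_mk_rep ℂ _ hne'
      have := hvan (Projectivization.mk ℂ _ hne') (by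
        rw [← hc, Units.smul_def, map_smul]
        simpa using smul_mem_conormal (c : ℂ) hh')
      rw [← hc, Units.smul_def, IsHomogeneous.eval_smul_eq hF] at this
      rw [eval_pull]
      exact (mul_eq_zero.1 this).resolve_left (pow_ne_zero _ c.ne_zero)

end ConeTheory

/-! ### Tangency to the scroll as degeneracy of a bordered symmetric matrix. -/

section Model

/-- Indices for the coefficients of the pairs consisting of a bilinear form on `ℂ^α × ℂ^β` and a
quadratic form on `ℂ^β`. -/
abbrev FormIndex (α β : Type) : Type := (α × β) ⊕ Sym2 β

variable {α β : Type}

/-- The vector with coordinates `y_i x_k` and `t x_k x_l`. -/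
def scrollVector {R : Type} [CommRing R] (y : α → R) (t : R) (x : β → R) : FormIndex α β → R :=
  Sum.elim (fun p => y p.1 * x p.2) (fun s => t * (s.map x).mul)

@[simp] lemma scrollVector_inl {R : Type} [CommRing R] (y : α → R) (t : R) (x : β → R) (i k) :
    scrollVector y t x (Sum.inl (i, k)) = y i * x k := rfl

@[simp] lemma scrollVector_inr {R : Type} [CommRing R] (y : α → R) (t : R) (x : β → R) (k l) :
    scrollVector y t x (Sum.inr s(k, l)) = t * (x k * x l) := rfl

lemma formIndex_funext {γ : Type} {v w : FormIndex α β → γ}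
    (h₁ : ∀ i k, v (Sum.inl (i, k)) = w (Sum.inl (i, k)))
    (h₂ : ∀ k l, v (Sum.inr s(k, l)) = w (Sum.inr s(k, l))) : v = w := by
  funext c
  rcases c with ⟨i, k⟩ | s
  · exact h₁ i k
  · induction s with | _ k l => exact h₂ k l

variable (α β) in
/-- The punctured affine cone over the scroll, in the coordinates `FormIndex α β`. -/
def scrollCone : Set (FormIndex α β → ℂ) :=
  {v | v ≠ 0 ∧ ∃ (y : α → ℂ) (t : ℂ) (x : β → ℂ), v = scrollVector y t x}

/-- The velocity of `scrollVector y t x` in the direction `(y', 0, x')`. -/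
def scrollVelocity (y : α → ℂ) (t : ℂ) (x : β → ℂ) (y' : α → ℂ) (x' : β → ℂ) :
    FormIndex α β → ℂ :=
  Sum.elim (fun p => y' p.1 * x p.2 + y p.1 * x' p.2)
    (Sym2.lift ⟨fun k l => t * (x k * x' l + x l * x' k), fun k l => by ring⟩)

@[simp] lemma scrollVelocity_inl (y : α → ℂ) (t : ℂ) (x : β → ℂ) (y' : α → ℂ) (x' : β → ℂ) (i k) :
    scrollVelocity y t x y' x' (Sum.inl (i, k)) = y' i * x k + y i * x' k := rfl

@[simp] lemma scrollVelocity_inr (y : α → ℂ) (t : ℂ) (x : β → ℂ) (y' : α → ℂ) (x' : β → ℂ) (k l) :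
    scrollVelocity y t x y' x' (Sum.inr s(k, l)) = t * (x k * x' l + x l * x' k) := rfl

/-- The Hessian matrix of the polynomial function `q(x) + b(y, x)`, where `q` is the quadratic form
and `b` the bilinear form with the given coefficients. -/
def borderedMatrix {R : Type} [CommRing R] [DecidableEq β] (h : FormIndex α β → R) :
    Matrix (β ⊕ α) (β ⊕ α) R :=
  Matrix.fromBlocks (Matrix.of fun k l => (if k = l then 2 else 1) * h (Sum.inr s(k, l)))
    (Matrix.of fun k i => h (Sum.inl (i, k))) (Matrix.of fun i k => h (Sum.inl (i, k))) 0

variable [Fintype α] [Fintype β] [DecidableEq α] [DecidableEq β]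

/-- Sorting ordered pairs by their unordered pair: an off-diagonal fibre has two elements and the
diagonal one has a single element. This accounts for the factor 2 on the diagonal of
`borderedMatrix`. -/
lemma sum_sym2_mul (h : Sym2 β → ℂ) (a b : β → ℂ) (φ : Sym2 β → ℂ)
    (hφ : ∀ k l, φ s(k, l) = a k * b l + a l * b k) :
    ∑ s, h s * φ s = ∑ k, ∑ l, (if k = l then 2 else 1) * h s(k, l) * (a k * b l) := by
  rw [← Fintype.sum_prod_type' (f := fun k l => (if k = l then 2 else 1) * h s(k, l) * (a k * b l)),
    ← Finset.sum_fiberwise Finset.univ (fun p : β × β => s(p.1, p.2))]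
  refine Finset.sum_congr rfl fun s _ => ?_
  induction s with | _ k l =>
  rw [hφ]
  by_cases hkl : k = l
  · subst hkl
    have : (Finset.univ.filter fun p : β × β => s(p.1, p.2) = s(k, k)) = {(k, k)} := by
      ext ⟨p, q⟩
      simp
    rw [this, Finset.sum_singleton, if_pos rfl]
    ring
  · have : (Finset.univ.filter fun p : β × β => s(p.1, p.2) = s(k, l)) = {(k, l), (l, k)} := by
      ext ⟨p, q⟩
      simp
    rw [this, Finset.sum_pair (by simp [hkl]), if_neg hkl, if_neg (Ne.symm hkl), Sym2.eq_swap]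
    ring

/-- Scaling the direction `y'` by `t` turns the derivative of `b(y, x) + t q(x)` into the symmetric
form of the Hessian evaluated on `(t x, y)` and `(x', y')`. The identity also holds for `t = 0`, so
points outside the chart `t = 1` need no separate treatment. -/
lemma dotProduct_scrollVelocity (h : FormIndex α β → ℂ) (y : α → ℂ) (t : ℂ) (x : β → ℂ)
    (y' : α → ℂ) (x' : β → ℂ) :
    h ⬝ᵥ scrollVelocity y t x (t • y') x' =
      Sum.elim x' y' ⬝ᵥ (borderedMatrix h *ᵥ Sum.elim (t • x) y) := by
  have key := sum_sym2_mul (fun s => h (Sum.inr s)) x' (t • x)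
    (fun s => scrollVelocity y t x (t • y') x' (Sum.inr s)) fun k l => by simp; ring
  rw [dotProduct, Fintype.sum_sum_type, key]
  simp only [borderedMatrix, Matrix.fromBlocks_mulVec, Sum.elim_comp_inl, Sum.elim_comp_inr,
    Matrix.zero_mulVec, add_zero, sumElim_dotProduct_sumElim]
  simp only [dotProduct, Matrix.mulVec, Fintype.sum_prod_type, Matrix.of_apply, Pi.add_apply,
    scrollVelocity_inl, mul_add, Finset.sum_add_distrib, Finset.mul_sum, Pi.smul_apply, smul_eq_mul]
  rw [add_comm, Finset.sum_comm (f := fun i k => h (Sum.inl (i, k)) * (y i * x' k)), ← add_assoc,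
    add_right_comm]
  congr 1
  · congr 1 <;> refine Finset.sum_congr rfl fun k _ => Finset.sum_congr rfl fun l _ => by ring
  · exact Finset.sum_congr rfl fun k _ => Finset.sum_congr rfl fun l _ => by ring

lemma differential_scrollVelocity (y : α → ℂ) (t : ℂ) (x : β → ℂ) (y' : α → ℂ) (x' : β → ℂ)
    (h0 : scrollVector y t x ≠ 0) {F : MvPolynomial (FormIndex α β) ℂ}
    (hF : F ∈ vanishingIdeal ℂ (scrollCone α β)) :
    differential (scrollVector y t x) F (scrollVelocity y t x y' x') = 0 := by
  let γ : FormIndex α β → Polynomial ℂ :=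
    scrollVector (fun i => Polynomial.C (y i) + Polynomial.X * Polynomial.C (y' i)) (Polynomial.C t)
      (fun k => Polynomial.C (x k) + Polynomial.X * Polynomial.C (x' k))
  have hev : ∀ s : ℂ, (fun c => (γ c).eval s) =
      scrollVector (fun i => y i + s * y' i) t (fun k => x k + s * x' k) := fun s =>
    formIndex_funext (fun i k => by simp [γ, mul_comm s])
      (fun k l => by simp [γ, mul_comm s])
  have hev0 : (fun c => (γ c).eval 0) = scrollVector y t x := by simp [hev]
  have hder : (fun c => (γ c).derivative.eval 0) = scrollVelocity y t x y' x' :=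
    formIndex_funext (fun i k => by simp [γ]) (fun k l => by simp [γ]; ring_nf; simp)
  have := differential_velocity_eq_zero γ (C := scrollCone α β)
    (fun s hs => ⟨hs, _, _, _, hev s⟩)
    (by rwa [hev0]) hF
  rwa [hev0, hder] at this

lemma det_borderedMatrix_eq_zero_of_mem_conormal {h : FormIndex α β → ℂ}
    (hh : h ∈ conormal (scrollCone α β)) : (borderedMatrix h).det = 0 := by
  obtain ⟨v, ⟨⟨hv0, y, t, x, rfl⟩, -⟩, hw⟩ := hh
  refine Matrix.exists_mulVec_eq_zero_iff.1 ⟨Sum.elim (t • x) y, fun h0 => hv0 ?_, ?_⟩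
  · have hx : ∀ k, t * x k = 0 := fun k => congrFun h0 (Sum.inl k)
    have hy : ∀ i, y i = 0 := fun i => congrFun h0 (Sum.inr i)
    refine formIndex_funext (fun i k => by simp [hy]) fun k l => ?_
    rw [scrollVector_inr, ← mul_assoc, hx, zero_mul, Pi.zero_apply]
  · refine dotProduct_eq_zero _ fun z => ?_
    have := dotProduct_scrollVelocity h y t x (z ∘ Sum.inr) (z ∘ Sum.inl)
    rw [hw _ fun F hF => differential_scrollVelocity _ _ _ _ _ hv0 hF, Sum.elim_comp_inl_inr] at this
    rw [dotProduct_comm, ← this]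

/-- In the chart where the coordinate with index `(j, j)` does not vanish, the `c`-th coordinate of
a point of the scroll is determined by this equation. -/
noncomputable def chartEquation (j : β) (c : FormIndex α β) : MvPolynomial (FormIndex α β) ℂ :=
  X c * X (Sum.inr s(j, j)) -
    Sum.elim (fun p => X (Sum.inl (p.1, j)) * X (Sum.inr s(p.2, j)))
      (fun s => (s.map fun k => X (Sum.inr s(k, j))).mul) c

/-- The coordinates which parametrise the chart. -/
def IsChartCoordinate (j : β) : FormIndex α β → Prop :=
  Sum.elim (fun p => p.2 = j) (fun s => j ∈ s)

lemma chartEquation_mem_vanishingIdeal (j : β) (c : FormIndex α β) :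
    chartEquation j c ∈ vanishingIdeal ℂ (scrollCone α β) := by
  rw [mem_vanishingIdeal_iff_eval]
  rintro _ ⟨-, y, t, x, rfl⟩
  rcases c with ⟨i, k⟩ | s
  · simp [chartEquation]; ring
  · induction s with | _ k l => simp [chartEquation]; ring

lemma differential_chartEquation_inl (j : β) (i : α) (k : β) (v w : FormIndex α β → ℂ) :
    differential v (chartEquation j (Sum.inl (i, k))) w =
      w (Sum.inl (i, k)) * v (Sum.inr s(j, j)) + v (Sum.inl (i, k)) * w (Sum.inr s(j, j)) -
      (w (Sum.inl (i, j)) * v (Sum.inr s(k, j)) + v (Sum.inl (i, j)) * w (Sum.inr s(k, j))) := by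
  simp [chartEquation, differential_sub, differential_mul]

lemma differential_chartEquation_inr (j k l : β) (v w : FormIndex α β → ℂ) :
    differential v (chartEquation j (Sum.inr s(k, l))) w =
      w (Sum.inr s(k, l)) * v (Sum.inr s(j, j)) + v (Sum.inr s(k, l)) * w (Sum.inr s(j, j)) -
      (w (Sum.inr s(k, j)) * v (Sum.inr s(l, j)) + v (Sum.inr s(k, j)) * w (Sum.inr s(l, j))) := by
  simp [chartEquation, differential_sub, differential_mul]

/-- Where the coordinate `(j, j)` is nonzero, the chart equations solve for all other coordinates in
terms of the chart coordinates. Each equation contains exactly one non-chart coordinate, with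
coefficient the `(j, j)` coordinate, so the differentials are independent. -/
lemma isSmoothVector_scrollVector (y : α → ℂ) (x : β → ℂ) (hx : x ≠ 0) :
    IsSmoothVector (scrollCone α β) (scrollVector y 1 x) := by
  classical
  obtain ⟨j, hj⟩ := Function.ne_iff.1 hx
  have hj : x j ≠ 0 := hj
  refine ⟨⟨fun h => ?_, y, 1, x, rfl⟩, ?_⟩
  · simpa [hj] using congrFun h (Sum.inr s(j, j))
  let e := Fintype.equivFin {c : FormIndex α β // ¬ IsChartCoordinate j c}
  refine ⟨_, fun k => chartEquation j (e.symm k), X (Sum.inr s(j, j)),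
    fun k => chartEquation_mem_vanishingIdeal _ _, ?_, by simp [hj], fun w hw hF => ?_⟩
  · have hli : LinearIndependent ℂ fun c : {c : FormIndex α β // ¬ IsChartCoordinate j c} =>
        differential (scrollVector y 1 x) (chartEquation j (c : FormIndex α β)) := by
      rw [Fintype.linearIndependent_iff]
      intro g hg c
      -- Evaluated on the basis vector of a non-chart coordinate, only the differential of its own
      -- equation survives.
      have := LinearMap.congr_fun hg (Pi.single (c : FormIndex α β) 1)
      rw [LinearMap.sum_apply, Finset.sum_eq_single c] at this
      · obtain ⟨⟨i, k⟩ | s, hc⟩ := c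
        · have hc : k ≠ j := hc
          simpa [differential_chartEquation_inl, Pi.single_apply, hc.symm, hj] using this
        · induction s with | _ k l =>
          obtain ⟨h1, h2⟩ : j ≠ k ∧ j ≠ l := by
            simpa [IsChartCoordinate] using hc
          simpa [differential_chartEquation_inr, Pi.single_apply, h1, h2, hj] using this
      · obtain ⟨⟨i, k⟩ | s, hc⟩ := c
        · have hc : k ≠ j := hc
          rintro ⟨⟨i', k'⟩ | s', hc'⟩ - hne
          · have hne : ¬ (i' = i ∧ k' = k) := by simpa using hne
            simp [differential_chartEquation_inl, Pi.single_apply, hc.symm]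
            intros
            simp_all
          · induction s' with | _ k' l' =>
            simp [differential_chartEquation_inr]
        · induction s with | _ k l =>
          obtain ⟨h1, h2⟩ : j ≠ k ∧ j ≠ l := by
            simpa [IsChartCoordinate] using hc
          rintro ⟨⟨i', k'⟩ | s', hc'⟩ - hne
          · simp [differential_chartEquation_inl, h1, h2]
          · induction s' with | _ k' l' =>
            have hne : ¬ s(k', l') = s(k, l) := fun h => hne (by simp [h])
            simp only [LinearMap.smul_apply, differential_chartEquation_inr, Pi.single_apply,
              Sum.inr.injEq, hne]
            simp [h1, h2]
      · simp
    exact hli.comp _ e.symm.injective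
  · have hw : w (Sum.inr s(j, j)) ≠ 0 := by simpa using hw
    have hF' : ∀ c : FormIndex α β, ¬ IsChartCoordinate j c → eval w (chartEquation j c) = 0 :=
      fun c hc => by simpa using hF (e ⟨c, hc⟩)
    refine ⟨fun h => hw (by simp [h]), fun i => w (Sum.inl (i, j)) / w (Sum.inr s(j, j)),
      1 / w (Sum.inr s(j, j)), fun k => w (Sum.inr s(k, j)),
      formIndex_funext (fun i k => ?_) fun k l => ?_⟩
    · by_cases hk : k = j
      · subst hk
        simp [hw]
      · have := hF' (Sum.inl (i, k)) hk
        simp [chartEquation] at this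
        rw [scrollVector_inl]
        field_simp
        linear_combination this
    · by_cases hk : j ∈ s(k, l)
      · rcases Sym2.mem_iff.1 hk with rfl | rfl
        · rw [scrollVector_inr, Sym2.eq_swap (a := l)]
          field_simp
        · rw [scrollVector_inr]
          field_simp
      · have := hF' (Sum.inr s(k, l)) hk
        simp [chartEquation] at this
        rw [scrollVector_inr]
        field_simp
        linear_combination this

/-- The differentiated chart equations determine `w` from its chart coordinates. The witnesses solve
`w_jj = 2 x_j x'_j`, `w_kj = x_k x'_j + x_j x'_k` and `w_ij = y'_i x_j + y_i x'_j`; the direction of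
`t` is not needed, since rescaling `x` and `y` absorbs it. -/
lemma exists_eq_scrollVelocity (y : α → ℂ) (x : β → ℂ) (hx : x ≠ 0) (w : FormIndex α β → ℂ)
    (hw : ∀ F ∈ vanishingIdeal ℂ (scrollCone α β), differential (scrollVector y 1 x) F w = 0) :
    ∃ y' x', w = scrollVelocity y 1 x y' x' := by
  obtain ⟨j, hj⟩ := Function.ne_iff.1 hx
  have hj : x j ≠ 0 := hj
  refine ⟨fun i => w (Sum.inl (i, j)) / x j - y i * w (Sum.inr s(j, j)) / (2 * x j ^ 2),
    fun k => w (Sum.inr s(k, j)) / x j - w (Sum.inr s(j, j)) * x k / (2 * x j ^ 2),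
    formIndex_funext (fun i k => ?_) fun k l => ?_⟩
  · have := hw _ (chartEquation_mem_vanishingIdeal j (Sum.inl (i, k)))
    rw [differential_chartEquation_inl] at this
    simp only [scrollVector_inl, scrollVector_inr] at this
    rw [scrollVelocity_inl]
    field_simp
    linear_combination (2 : ℂ) * this
  · have := hw _ (chartEquation_mem_vanishingIdeal j (Sum.inr s(k, l)))
    rw [differential_chartEquation_inr] at this
    simp only [scrollVector_inr] at this
    rw [scrollVelocity_inr]
    field_simp
    linear_combination (2 : ℂ) * this

lemma mem_conormal_of_mulVec_eq_zero {h : FormIndex α β → ℂ} (x : β → ℂ) (y : α → ℂ) (hx : x ≠ 0)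
    (hN : borderedMatrix h *ᵥ Sum.elim x y = 0) : h ∈ conormal (scrollCone α β) := by
  refine ⟨_, isSmoothVector_scrollVector y x hx, fun w hw => ?_⟩
  obtain ⟨y', x', rfl⟩ := exists_eq_scrollVelocity y x hx w hw
  have := dotProduct_scrollVelocity h y 1 x y' x'
  rwa [one_smul, one_smul, hN, dotProduct_zero] at this

end Model

/-! ### Irreducibility of the bordered determinant by specialisation. -/

section Irreducible

lemma natDegree_aeval_le_totalDegree {σ R : Type} [CommRing R] [Algebra ℂ R]
    (f : σ → Polynomial R) (hf : ∀ i, (f i).natDegree ≤ 1) (F : MvPolynomial σ ℂ) :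
    (aeval f F).natDegree ≤ F.totalDegree := by
  have := aeval_natDegree_le (map (algebraMap ℂ R) F) (m := F.totalDegree) (n := 1)
    (Finset.sup_mono (support_map_subset _ _)) f hf
  rwa [aeval_map_algebraMap, mul_one] at this

/-- A polynomial is irreducible if some specialisation to polynomials of degree at most one is
irreducible and does not decrease the degree. -/
lemma irreducible_of_irreducible_aeval {σ R : Type} [CommRing R] [IsDomain R] [Algebra ℂ R]
    (f : σ → Polynomial R) (hf : ∀ i, (f i).natDegree ≤ 1) {P : MvPolynomial σ ℂ}
    (hirr : Irreducible (aeval f P)) (hdeg : P.totalDegree ≤ (aeval f P).natDegree) :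
    Irreducible P := by
  have hP : P ≠ 0 := fun h => hirr.ne_zero (by simp [h])
  have key : ∀ F G : MvPolynomial σ ℂ, P = F * G → IsUnit (aeval f F) → IsUnit F := by
    rintro F G rfl hu
    have hF : F ≠ 0 := left_ne_zero_of_mul hP
    have hG : G ≠ 0 := right_ne_zero_of_mul hP
    rw [totalDegree_mul_of_isDomain hF hG] at hdeg
    rw [map_mul] at hdeg
    have h1 := Polynomial.natDegree_mul_le (p := aeval f F) (q := aeval f G)
    have h2 := natDegree_aeval_le_totalDegree f hf G
    have h3 := Polynomial.natDegree_eq_zero_of_isUnit hu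
    -- If `F` becomes a unit, the image of `P` has degree at most that of `G`; as no degree is lost,
    -- `F` is constant.
    have h4 : F.totalDegree = 0 := by omega
    rw [totalDegree_eq_zero_iff_eq_C] at h4
    rw [h4] at hF ⊢
    exact (isUnit_iff_ne_zero.2 fun h => hF (by rw [h, C_0])).map C
  refine ⟨fun h => hirr.not_isUnit (h.map _), fun F G h => ?_⟩
  rcases hirr.isUnit_or_isUnit (by rw [h, map_mul]) with h' | h'
  · exact Or.inl (key F G h h')
  · exact Or.inr (key G F (by rw [h, mul_comm]) h')

/-- The determinant of the characteristic matrix of the companion matrix of `T ^ (n + 1) - z`. -/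
lemma det_companion {R : Type} [CommRing R] (n : ℕ) (t z : R) :
    (Matrix.of fun i j : Fin (n + 1) => (if i = j then t else 0) -
      (if (i : ℕ) = j + 1 then 1 else 0) - (if i = 0 ∧ j = Fin.last n then z else 0)).det =
      t ^ (n + 1) - z := by
  rw [Matrix.det_succ_row_zero]
  have h0 : (Matrix.submatrix (Matrix.of fun i j : Fin (n + 1) => (if i = j then t else 0) -
      (if (i : ℕ) = j + 1 then 1 else 0) - (if i = 0 ∧ j = Fin.last n then z else 0))
      Fin.succ (Fin.succAbove 0)).det = t ^ n := by
    rw [Matrix.det_of_isLowerTriangular]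
    · simp
    · intro i j hij
      have hij : i < j := hij
      have hij' : (i : ℕ) < j := hij
      simp only [Matrix.submatrix_apply, Matrix.of_apply, Fin.zero_succAbove, Fin.succ_inj,
        Fin.val_succ]
      rw [if_neg hij.ne, if_neg (by omega), if_neg (by simp)]
      simp
  have h1 : (Matrix.submatrix (Matrix.of fun i j : Fin (n + 1) => (if i = j then t else 0) -
      (if (i : ℕ) = j + 1 then 1 else 0) - (if i = 0 ∧ j = Fin.last n then z else 0))
      Fin.succ (Fin.succAbove (Fin.last n))).det = (-1) ^ n := by
    rw [Matrix.det_of_isUpperTriangular]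
    · have hne : ∀ i : Fin n, i.succ ≠ i.castSucc := fun i => Fin.castSucc_lt_succ.ne'
      simp [hne]
    · intro i j hij
      have hij : (j : ℕ) < i := hij
      have h2 : i.succ ≠ j.castSucc := fun h => by
        have := congrArg Fin.val h
        simp only [Fin.val_succ, Fin.val_castSucc] at this
        omega
      have h3 : (i : ℕ) ≠ j := by omega
      simp [h2, h3]
  have hrow : ∀ j : Fin (n + 1), (Matrix.of fun i j : Fin (n + 1) => (if i = j then t else 0) -
      (if (i : ℕ) = j + 1 then 1 else 0) - (if i = 0 ∧ j = Fin.last n then z else 0)) 0 j =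
      (if j = 0 then t else 0) - (if j = Fin.last n then z else 0) := fun j => by
    simp [eq_comm]
  -- The two entries of the first row are summed separately, so that `n = 0`, where columns `0` and
  -- `last` coincide, is included.
  simp only [hrow, mul_sub, sub_mul, Finset.sum_sub_distrib]
  rw [Finset.sum_eq_single 0, Finset.sum_eq_single (Fin.last n), h0, h1]
  · have : ((-1 : R) ^ n) * (-1) ^ n = 1 := by rw [← mul_pow]; simp
    simp only [if_true, Fin.val_zero, Fin.val_last]
    linear_combination (-z) * this
  · intro j _ hj; simp [hj]
  · simp
  · intro j _ hj; simp [hj]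
  · simp

/-- Eisenstein's criterion at the prime `z` of `ℂ[z]`, where `z` is the inner variable. -/
lemma irreducible_X_pow_sub_C_X (n : ℕ) :
    Irreducible (Polynomial.X ^ (n + 1) - Polynomial.C Polynomial.X :
      Polynomial (Polynomial ℂ)) := by
  have hmonic := Polynomial.monic_X_pow_sub_C (Polynomial.X : Polynomial ℂ) n.succ_ne_zero
  have hdeg : (Polynomial.X ^ (n + 1) - Polynomial.C Polynomial.X :
      Polynomial (Polynomial ℂ)).degree = (n + 1 : ℕ) :=
    Polynomial.degree_X_pow_sub_C n.succ_pos _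
  refine Polynomial.irreducible_of_eisenstein_criterion (P := Ideal.span {Polynomial.X})
    ((Ideal.span_singleton_prime Polynomial.X_ne_zero).2 Polynomial.prime_X) ?_ (fun k hk => ?_)
    ?_ ?_ hmonic.isPrimitive
  · rw [hmonic.leadingCoeff, Ideal.mem_span_singleton]
    exact fun h => Polynomial.prime_X.not_isUnit (isUnit_of_dvd_one h)
  · rw [hdeg, Nat.cast_lt] at hk
    rw [Ideal.mem_span_singleton, Polynomial.coeff_sub, Polynomial.coeff_X_pow, if_neg hk.ne,
      Polynomial.coeff_C]
    split_ifs <;> simp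
  · rw [hdeg]
    exact_mod_cast n.succ_pos
  · rw [Ideal.span_singleton_pow, Ideal.mem_span_singleton]
    simp only [Polynomial.coeff_sub, Polynomial.coeff_X_pow, Polynomial.coeff_C_zero]
    rw [if_neg (by omega), zero_sub, dvd_neg]
    intro h
    simpa using Polynomial.X_pow_dvd_iff.1 h 1 (by norm_num)

variable {α β : Type} [Fintype α] [Fintype β] [DecidableEq α] [DecidableEq β]

lemma map_det_borderedMatrix {R S : Type} [CommRing R] [CommRing S] (f : R →+* S)
    (h : FormIndex α β → R) : f (borderedMatrix h).det = (borderedMatrix (f ∘ h)).det := by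
  rw [RingHom.map_det]
  congr 1
  ext (k | i) (l | j)
  · by_cases hkl : k = l <;> simp [borderedMatrix, hkl, map_ofNat f 2]
  · simp [borderedMatrix]
  · simp [borderedMatrix]
  · simp [borderedMatrix]

variable (α β) in
/-- The determinant of the bordered symmetric matrix, as a polynomial in the coefficients. -/
noncomputable def borderedDet : MvPolynomial (FormIndex α β) ℂ :=
  (borderedMatrix X).det

lemma eval_borderedDet (h : FormIndex α β → ℂ) :
    eval h (borderedDet α β) = (borderedMatrix h).det := by
  rw [borderedDet, map_det_borderedMatrix]
  congr 2
  ext c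
  simp

lemma aeval_borderedDet {R : Type} [CommRing R] [Algebra ℂ R] (h : FormIndex α β → R) :
    aeval h (borderedDet α β) = (borderedMatrix h).det := by
  rw [← AlgHom.coe_toRingHom, borderedDet, map_det_borderedMatrix]
  congr 2
  ext c
  simp

lemma borderedDet_isHomogeneous :
    (borderedDet α β).IsHomogeneous (Fintype.card β + Fintype.card α) := by
  have hentry : ∀ a b, (borderedMatrix (X : FormIndex α β → MvPolynomial (FormIndex α β) ℂ)
      a b).IsHomogeneous 1 := by
    rintro (k | i) (l | j)
    · have : (if k = l then 2 else 1 : MvPolynomial (FormIndex α β) ℂ) =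
          C (if k = l then 2 else 1) := by
        split_ifs
        · exact (map_ofNat C 2).symm
        · exact C_1.symm
      simp only [borderedMatrix, Matrix.fromBlocks_apply₁₁, Matrix.of_apply, this]
      exact isHomogeneous_C_mul_X _ _
    · exact isHomogeneous_X _ _
    · exact isHomogeneous_X _ _
    · exact isHomogeneous_zero _ _ _
  rw [borderedDet, Matrix.det_apply]
  refine IsHomogeneous.sum _ _ _ fun σ _ => ?_
  have := IsHomogeneous.prod Finset.univ (fun a => borderedMatrix X (σ a) a) (fun _ => 1)
    fun a _ => hentry (σ a) a
  simp only [Finset.sum_const, Finset.card_univ, Fintype.card_sum, smul_eq_mul, mul_one] at this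
  rcases Int.units_eq_one_or (Equiv.Perm.sign σ) with h | h <;> rw [h]
  · rwa [one_smul]
  · rw [Units.neg_smul, one_smul]
    exact this.neg

/-- The entries of the symmetric matrix obtained from the characteristic matrix of the companion
matrix of `T ^ N - z` by reversing the columns. -/
noncomputable def hankelEntry (N a b : ℕ) : Polynomial (Polynomial ℂ) :=
  (if a + b + 1 = N then Polynomial.X else 0) - (if a + b = N then 1 else 0) -
    (if a = 0 ∧ b = 0 then Polynomial.C Polynomial.X else 0)

lemma hankelEntry_comm (N a b : ℕ) : hankelEntry N a b = hankelEntry N b a := by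
  simp only [hankelEntry, add_comm a b, and_comm]

lemma natDegree_hankelEntry_le (N a b : ℕ) : (hankelEntry N a b).natDegree ≤ 1 := by
  refine (Polynomial.natDegree_sub_le_of_le (Polynomial.natDegree_sub_le_of_le (m := 1) (n := 1)
    ?_ ?_) (n := 1) ?_).trans (by simp) <;> split_ifs <;> simp

/-- Coefficients whose bordered matrix has the entries `hankelEntry`. -/
noncomputable def hankelForm (r n : ℕ) :
    FormIndex (Fin r) (Fin n) → Polynomial (Polynomial ℂ) :=
  Sum.elim (fun p => hankelEntry (n + r) p.2 (n + p.1))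
    (Sym2.lift ⟨fun k l => algebraMap ℂ _ (if k = l then 2⁻¹ else 1) * hankelEntry (n + r) k l,
      fun k l => by simp only [hankelEntry_comm, eq_comm]⟩)

lemma natDegree_hankelForm_le (r n : ℕ) (c : FormIndex (Fin r) (Fin n)) :
    (hankelForm r n c).natDegree ≤ 1 := by
  rcases c with ⟨i, k⟩ | s
  · exact natDegree_hankelEntry_le _ _ _
  · induction s with | _ k l =>
    refine (Polynomial.natDegree_C_mul_le _ _).trans (natDegree_hankelEntry_le _ _ _)

/-- The factor `2⁻¹` in `hankelForm` cancels the diagonal 2 of the Hessian. The lower right block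
vanishes as required because there `a + b ≥ 2n > n + r`; this is where `r < n` enters. -/
lemma borderedMatrix_hankelForm {r n : ℕ} (hrn : r < n) (a b : Fin n ⊕ Fin r) :
    borderedMatrix (hankelForm r n) a b =
      hankelEntry (n + r) (finSumFinEquiv a) (finSumFinEquiv b) := by
  rcases a with k | i <;> rcases b with l | j
  · simp only [borderedMatrix, Matrix.fromBlocks_apply₁₁, Matrix.of_apply, hankelForm, Sum.elim_inr,
      Sym2.lift_mk, finSumFinEquiv_apply_left, Fin.val_castAdd]
    split_ifs
    · rw [← mul_assoc, ← map_ofNat (algebraMap ℂ (Polynomial (Polynomial ℂ))) 2, ← map_mul]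
      simp
    · simp
  · simp [borderedMatrix, hankelForm]
  · simp [borderedMatrix, hankelForm, hankelEntry_comm _ (l : ℕ)]
  · have h1 : ¬ (n + (i : ℕ) + (n + j) + 1 = n + r) := by omega
    have h2 : ¬ (n + (i : ℕ) + (n + j) = n + r) := by omega
    have h3 : n ≠ 0 := by omega
    simp [borderedMatrix, hankelEntry, h1, h2, h3]

lemma det_borderedMatrix_hankelForm {r n : ℕ} (hrn : r < n) :
    ∃ ε : ℤˣ, (Polynomial.X ^ (n + r) - Polynomial.C Polynomial.X : Polynomial (Polynomial ℂ)) =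
      ((ε : ℤ) : Polynomial (Polynomial ℂ)) * (borderedMatrix (hankelForm r n)).det := by
  obtain ⟨N, hN⟩ : ∃ N, n + r = N + 1 := ⟨n + r - 1, by omega⟩
  let e : Fin n ⊕ Fin r ≃ Fin (N + 1) := finSumFinEquiv.trans (finCongr hN)
  refine ⟨Equiv.Perm.sign (Fin.revPerm : Equiv.Perm (Fin (N + 1))), ?_⟩
  rw [← Matrix.det_submatrix_equiv_self e.symm, ← Matrix.det_permute', hN, ← det_companion]
  congr 1
  ext1 i j
  have hval : ∀ i : Fin (N + 1), ((finSumFinEquiv (e.symm i) : Fin (n + r)) : ℕ) = i := fun i => by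
    simp [e]
  rw [Matrix.submatrix_apply, Matrix.submatrix_apply, borderedMatrix_hankelForm hrn, hval, hval]
  simp only [Matrix.of_apply, hankelEntry, id, Fin.revPerm_apply, Fin.val_rev, hN]
  congr 2
  · congr 1
    · simp only [Fin.ext_iff, eq_iff_iff]; omega
  · congr 1
    · simp only [eq_iff_iff]; omega
  · simp only [Fin.ext_iff, eq_iff_iff, Fin.val_last, Fin.val_zero]; omega

theorem irreducible_borderedDet {r n : ℕ} (hrn : r < n) :
    Irreducible (borderedDet (Fin r) (Fin n)) := by
  obtain ⟨ε, hε⟩ := det_borderedMatrix_hankelForm hrn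
  obtain ⟨N, hN⟩ : ∃ N, n + r = N + 1 := ⟨n + r - 1, by omega⟩
  have hunit : IsUnit ((ε : ℤ) : Polynomial (Polynomial ℂ)) := by
    exact ε.isUnit.map (Int.castRingHom _)
  have hassoc : Associated (borderedMatrix (hankelForm r n)).det
      (Polynomial.X ^ (n + r) - Polynomial.C Polynomial.X) := by
    rw [hε]
    exact (associated_unit_mul_left _ _ hunit).symm
  refine irreducible_of_irreducible_aeval (hankelForm r n) (natDegree_hankelForm_le r n) ?_ ?_
  · rw [aeval_borderedDet]
    refine hassoc.irreducible_iff.2 ?_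
    rw [hN]
    exact irreducible_X_pow_sub_C_X N
  · rw [aeval_borderedDet]
    have hdeg := Polynomial.natDegree_eq_of_degree_eq (Polynomial.degree_eq_degree_of_associated hassoc)
    rw [Polynomial.natDegree_X_pow_sub_C] at hdeg
    rw [hdeg]
    simpa using (borderedDet_isHomogeneous (α := Fin r) (β := Fin n)).totalDegree_le

end Irreducible

/-! ### Density of the conormal vectors in the determinantal hypersurface, and equations of the
scroll. -/

section Closure

variable {α β : Type} [Fintype α] [Fintype β] [DecidableEq α] [DecidableEq β]

/-- On a pencil `a + c b` the quadratic form is `q c² + 2 s c + p`, which has a root over `ℂ` unless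
`q = 0`, and in that case `b` itself is isotropic. -/
lemma exists_isotropic (M : Matrix β β ℂ) (hM : M.IsSymm) (K : Submodule ℂ (β → ℂ))
    (hK : 1 < Module.finrank ℂ K) : ∃ x ∈ K, x ≠ 0 ∧ x ⬝ᵥ (M *ᵥ x) = 0 := by
  have : Nontrivial K := Module.nontrivial_of_finrank_pos (R := ℂ) (by omega)
  obtain ⟨a, ha⟩ := exists_ne (0 : K)
  obtain ⟨b, hb⟩ := exists_linearIndependent_pair_of_one_lt_finrank hK ha
  rw [LinearIndependent.pair_iff] at hb
  have hsymm : (b : β → ℂ) ⬝ᵥ (M *ᵥ a) = (a : β → ℂ) ⬝ᵥ (M *ᵥ b) := by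
    rw [Matrix.dotProduct_mulVec, ← Matrix.mulVec_transpose, hM.eq, dotProduct_comm]
  set p := (a : β → ℂ) ⬝ᵥ (M *ᵥ a) with hp
  set q := (b : β → ℂ) ⬝ᵥ (M *ᵥ b) with hq
  set s := (a : β → ℂ) ⬝ᵥ (M *ᵥ b) with hs
  by_cases hq0 : q = 0
  · refine ⟨b, b.2, fun h => ?_, hq0⟩
    have := hb 0 1 (by simp only [zero_smul, one_smul, zero_add]; exact Subtype.ext h)
    exact one_ne_zero this.2
  · obtain ⟨δ, hδ⟩ := IsAlgClosed.exists_pow_nat_eq (s ^ 2 - p * q) two_pos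
    refine ⟨(a + ((δ - s) / q) • b : K), Subtype.property _, fun h => ?_, ?_⟩
    · have := hb 1 ((δ - s) / q) (by rw [one_smul]; exact Subtype.ext h)
      exact one_ne_zero this.1
    · simp only [Submodule.coe_add, Submodule.coe_smul, Matrix.mulVec_add, Matrix.mulVec_smul,
        add_dotProduct, dotProduct_add, smul_dotProduct, dotProduct_smul, smul_eq_mul, hsymm,
        ← hp, ← hq, ← hs]
      field_simp
      linear_combination hδ

lemma eval_eq_zero_of_line {ι : Type} [Fintype ι] {C : Set (ι → ℂ)} (h g : ι → ℂ) (h0 : h ≠ 0)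
    (hmem : ∀ ε : ℂ, ε ≠ 0 → h + ε • g ∈ C) {F : MvPolynomial ι ℂ}
    (hF : ∀ h' ∈ C, h' ≠ 0 → eval h' F = 0) : eval h F = 0 := by
  obtain ⟨i, hi⟩ := Function.ne_iff.1 h0
  let γ : ι → Polynomial ℂ := fun i => Polynomial.C (h i) + Polynomial.X * Polynomial.C (g i)
  have hγ : ∀ s, (fun i => (γ i).eval s) = h + s • g := fun s => by
    ext i
    simp [γ, mul_comm s]
  -- The factor `X` covers `s = 0`, where membership in `C` is unknown, and `γ i` covers a possible
  -- passage of the line through the origin.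
  have hprod : aeval γ F * (γ i * Polynomial.X) = 0 := by
    refine Polynomial.funext fun s => ?_
    rw [Polynomial.eval_mul, Polynomial.eval_mul, Polynomial.eval_zero, eval_aeval_curve, hγ,
      Polynomial.eval_X]
    by_cases hs : s = 0
    · simp [hs]
    by_cases hs' : h + s • g = 0
    · have : (γ i).eval s = 0 := by
        have := congrFun (hγ s) i
        rwa [hs'] at this
      rw [this, zero_mul, mul_zero]
    · rw [hF _ (hmem s hs) hs', zero_mul]
  have hne : γ i * Polynomial.X ≠ 0 := mul_ne_zero
    (fun h' => hi (by simpa [γ] using congrArg (Polynomial.eval 0) h')) Polynomial.X_ne_zero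
  have := eval_aeval_curve γ F 0
  rw [(mul_eq_zero.1 hprod).resolve_right hne, hγ] at this
  simpa using this.symm

/-- Every vector with degenerate bordered matrix is a limit of conormal vectors of the scroll. -/
lemma eval_eq_zero_of_det_borderedMatrix_eq_zero (hcard : Fintype.card α < Fintype.card β)
    {h : FormIndex α β → ℂ} (h0 : h ≠ 0) (hdet : (borderedMatrix h).det = 0)
    {F : MvPolynomial (FormIndex α β) ℂ}
    (hF : ∀ h' ∈ conormal (scrollCone α β), h' ≠ 0 → eval h' F = 0) : eval h F = 0 := by
  obtain ⟨z, hz0, hz⟩ := Matrix.exists_mulVec_eq_zero_iff.2 hdet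
  obtain ⟨x, y, rfl⟩ : ∃ x y, z = Sum.elim x y := ⟨_, _, (Sum.elim_comp_inl_inr z).symm⟩
  by_cases hx : x = 0
  swap
  · exact hF h (mem_conormal_of_mulVec_eq_zero x y hx hz) h0
  subst hx
  set M : Matrix β β ℂ := Matrix.of fun k l => (if k = l then 2 else 1) * h (Sum.inr s(k, l)) with hM
  set B : Matrix α β ℂ := Matrix.of fun i k => h (Sum.inl (i, k)) with hB
  have hy0 : y ≠ 0 := fun hy => hz0 (by ext (k | i) <;> simp [hy])
  have hBy : Bᵀ *ᵥ y = 0 := by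
    have : (borderedMatrix h *ᵥ Sum.elim 0 y) ∘ Sum.inl = 0 := by rw [hz]; rfl
    rw [borderedMatrix, Matrix.fromBlocks_mulVec, Sum.elim_comp_inl, Sum.elim_comp_inl,
      Sum.elim_comp_inr, Matrix.mulVec_zero, zero_add] at this
    exact this
  -- Since `Bᵀ` kills `y ≠ 0`, `B` has rank at most `|α| - 1`, so its kernel has dimension at least
  -- `|β| - |α| + 1 ≥ 2`.
  have hker : 1 < Module.finrank ℂ (LinearMap.ker B.mulVecLin) := by
    have h1 := LinearMap.finrank_range_add_finrank_ker B.mulVecLin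
    have h2 := LinearMap.finrank_range_add_finrank_ker Bᵀ.mulVecLin
    have h3 : Bᵀ.rank = B.rank := B.rank_transpose
    have h4 : 0 < Module.finrank ℂ (LinearMap.ker Bᵀ.mulVecLin) :=
      Module.finrank_pos_iff_exists_ne_zero.2 ⟨⟨y, hBy⟩, fun h => hy0 (congrArg Subtype.val h)⟩
    rw [Module.finrank_fintype_fun_eq_card] at h1 h2
    simp only [Matrix.rank] at h3
    omega
  have hsymm : M.IsSymm := by
    ext k l
    simp only [hM, Matrix.transpose_apply, Matrix.of_apply, Sym2.eq_swap (a := l), eq_comm]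
  obtain ⟨x, hxK, hx0, hxM⟩ := exists_isotropic M hsymm _ hker
  have hBx : B *ᵥ x = 0 := hxK
  obtain ⟨i, hi⟩ := Function.ne_iff.1 hy0
  have hi : y i ≠ 0 := hi
  set u : α → ℂ := Pi.single i (y i)⁻¹ with hu
  have huy : u ⬝ᵥ y = 1 := by simp [hu, hi]
  -- Replacing `B` by `B - ε u (M x)ᵀ` puts `(x, ε⁻¹ y)` in the kernel: the upper block gives `M x -
  -- (u ⬝ y) M x = 0`, and the lower one `B x - ε (xᵀ M x) u = 0`.
  refine eval_eq_zero_of_line h (Sum.elim (fun p => - u p.1 * (M *ᵥ x) p.2) 0) h0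
    (fun ε hε => mem_conormal_of_mulVec_eq_zero x (ε⁻¹ • y) hx0 ?_) hF
  have hN : borderedMatrix (h + ε • Sum.elim (fun p => - u p.1 * (M *ᵥ x) p.2) 0) =
      Matrix.fromBlocks M (Bᵀ - ε • Matrix.vecMulVec (M *ᵥ x) u)
        (B - ε • Matrix.vecMulVec u (M *ᵥ x)) 0 := by
    ext (k | i) (l | j) <;> simp [borderedMatrix, Matrix.vecMulVec_apply, hM, hB] <;> ring
  rw [hN, Matrix.fromBlocks_mulVec, Sum.elim_comp_inl, Sum.elim_comp_inr, Matrix.zero_mulVec, add_zero,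
    Matrix.sub_mulVec, Matrix.sub_mulVec, Matrix.mulVec_smul, hBy, hBx, Matrix.smul_mulVec,
    Matrix.smul_mulVec, Matrix.vecMulVec_mulVec, Matrix.vecMulVec_mulVec, dotProduct_comm _ x, hxM,
    dotProduct_smul, huy]
  ext (k | i)
  · simp only [Sum.elim_inl, Pi.add_apply, Pi.sub_apply, Pi.smul_apply, smul_eq_mul, Pi.zero_apply,
      MulOpposite.smul_eq_mul_unop, MulOpposite.unop_op]
    field_simp
    simp
  · simp

/-- The dual variety of a variety linearly equivalent to the scroll of type `(1^r, 2)` over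
`ℙ^(n-1)`. -/
theorem isIrreducibleHypersurface_of_cone_eq {ι : Type} [Fintype ι] {r n : ℕ} (hrn : r < n)
    {Z : Set (ℙ ℂ (ι → ℂ))} (L : (FormIndex (Fin r) (Fin n) → ℂ) ≃ₗ[ℂ] (ι → ℂ))
    (hZ : cone Z = L '' scrollCone (Fin r) (Fin n)) :
    IsIrreducibleHypersurface (dualVariety Z) (n + r) := by
  have hhom := borderedDet_isHomogeneous (α := Fin r) (β := Fin n)
  rw [Fintype.card_fin, Fintype.card_fin] at hhom
  refine isIrreducibleHypersurface_dualVariety L hZ (irreducible_borderedDet hrn) hhom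
    (fun h hh => ?_) fun h h0 hh e F _ hF => ?_
  · rw [eval_borderedDet, det_borderedMatrix_eq_zero_of_mem_conormal hh]
  · rw [eval_borderedDet] at hh
    exact eval_eq_zero_of_det_borderedMatrix_eq_zero (by simpa using hrn) h0 hh hF

/-- The two-by-two minors vanishing on the scroll. -/
lemma mem_scrollCone_iff {v : FormIndex α β → ℂ} (hv : v ≠ 0) :
    v ∈ scrollCone α β ↔
      (∀ i j k l, v (Sum.inl (i, k)) * v (Sum.inl (j, l)) = v (Sum.inl (i, l)) * v (Sum.inl (j, k))) ∧
      (∀ i j k l, v (Sum.inl (i, k)) * v (Sum.inr s(j, l)) = v (Sum.inl (i, l)) * v (Sum.inr s(j, k))) ∧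
      (∀ i j k l, v (Sum.inr s(i, k)) * v (Sum.inr s(j, l)) =
        v (Sum.inr s(i, l)) * v (Sum.inr s(j, k))) := by
  constructor
  · rintro ⟨-, y, t, x, rfl⟩
    refine ⟨fun i j k l => ?_, fun i j k l => ?_, fun i j k l => ?_⟩ <;> simp <;> ring
  · rintro ⟨h1, h2, h3⟩
    refine ⟨hv, ?_⟩
    by_cases hS : ∃ k l, v (Sum.inr s(k, l)) ≠ 0
    · obtain ⟨k, l, hkl⟩ := hS
      -- Column `l` of the symmetric block serves as `x`; comparing with the entries at `(i, k)` and
      -- `(k, k)` gives `y` and `t`. No diagonal entry has to be nonzero.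
      refine ⟨fun i => v (Sum.inl (i, k)) / v (Sum.inr s(k, l)),
        v (Sum.inr s(k, k)) / v (Sum.inr s(k, l)) ^ 2, fun p => v (Sum.inr s(p, l)),
        formIndex_funext (fun i p => ?_) fun p q => ?_⟩
      · rw [scrollVector_inl]
        field_simp
        have := h2 i l p k
        rw [Sym2.eq_swap (a := l), Sym2.eq_swap (a := l)] at this
        exact this
      · rw [scrollVector_inr]
        field_simp
        have e1 := h3 p k q l
        have e2 := h3 q k k l
        have e3 := h3 p k k l
        rw [Sym2.eq_swap (a := q) (b := k)] at e2
        rw [Sym2.eq_swap (a := p) (b := k)] at e3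
        linear_combination v (Sum.inr s(k, l)) * e1 + v (Sum.inr s(p, l)) * e2
    · push Not at hS
      obtain ⟨c, hc⟩ := Function.ne_iff.1 hv
      rcases c with ⟨i, k⟩ | s
      · have hc : v (Sum.inl (i, k)) ≠ 0 := hc
        refine ⟨fun j => v (Sum.inl (j, k)) / v (Sum.inl (i, k)), 0, fun p => v (Sum.inl (i, p)),
          formIndex_funext (fun j p => ?_) fun p q => by simp [hS]⟩
        rw [scrollVector_inl]
        field_simp
        exact h1 _ _ _ _
      · induction s with | _ k l => exact absurd (hS k l) hc

/-- The cone is cut out by the quadrics of `mem_scrollCone_iff`, which pull back to homogeneous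
equations of degree 2. -/
lemma zariskiClosure_eq_of_cone_eq {ι : Type} [Fintype ι] {Z : Set (ℙ ℂ (ι → ℂ))}
    (L : (FormIndex α β → ℂ) ≃ₗ[ℂ] (ι → ℂ)) (hZ : cone Z = L '' scrollCone α β) :
    zariskiClosure Z = Z := by
  have hmem : ∀ p : ℙ ℂ (ι → ℂ), p ∈ Z ↔ L.symm p.rep ∈ scrollCone α β := fun p => by
    rw [← rep_mem_cone, hZ]
    exact ⟨by rintro ⟨v, hv, h⟩; rwa [← h, L.symm_apply_apply],
      fun h => ⟨_, h, L.apply_symm_apply _⟩⟩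
  refine Set.Subset.antisymm (fun p hp => ?_) fun p hp d F _ hF => hF p hp
  have hne : ∀ p : ℙ ℂ (ι → ℂ), L.symm p.rep ≠ 0 := fun p => by simpa using p.rep_nonzero
  have key : ∀ a b c d : FormIndex α β, (∀ v ∈ scrollCone α β, v a * v b = v c * v d) →
      L.symm p.rep a * L.symm p.rep b = L.symm p.rep c * L.symm p.rep d := by
    intro a b c d h
    have := hp 2 (pull L.symm.toLinearMap (X a * X b - X c * X d))
      (pull_isHomogeneous _ (((isHomogeneous_X _ _).mul (isHomogeneous_X _ _)).sub
        ((isHomogeneous_X _ _).mul (isHomogeneous_X _ _)))) fun q hq => by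
        rw [eval_pull]
        simpa [sub_eq_zero] using h _ ((hmem q).1 hq)
    rw [eval_pull] at this
    simpa [sub_eq_zero] using this
  rw [hmem, mem_scrollCone_iff (hne p)]
  exact ⟨fun i j k l => key _ _ _ _ fun v hv => ((mem_scrollCone_iff hv.1).1 hv).1 i j k l,
    fun i j k l => key _ _ _ _ fun v hv => ((mem_scrollCone_iff hv.1).1 hv).2.1 i j k l,
    fun i j k l => key _ _ _ _ fun v hv => ((mem_scrollCone_iff hv.1).1 hv).2.2 i j k l⟩

end Closure

/-! ### Identification of the scroll of type `(1^r, 2)` with the coordinate model. -/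

section Scroll

lemma onesTwo_castSucc {r : ℕ} (i : Fin r) : onesTwo r i.castSucc = 1 := by
  simp [onesTwo]

lemma onesTwo_last (r : ℕ) : onesTwo r (Fin.last r) = 2 := by
  simp [onesTwo]

/-- The coordinate of the scroll of type `(1^r, 2)` with a given index. -/
def toScrollIndex (m r : ℕ) : FormIndex (Fin r) (Fin (m + 1)) → ScrollIndex m (onesTwo r) :=
  Sum.elim (fun p => ⟨p.1.castSucc, Sym.cast (onesTwo_castSucc p.1).symm (Sym.oneEquiv p.2)⟩)
    (fun s => ⟨Fin.last r, Sym.cast (onesTwo_last r).symm (Sym2.equivSym _ s)⟩)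

lemma toScrollIndex_bijective (m r : ℕ) : Function.Bijective (toScrollIndex m r) := by
  constructor
  · rintro (⟨i, k⟩ | s) (⟨j, l⟩ | s') h
    · obtain ⟨h1, h2⟩ := Sigma.mk.inj h
      have hij : i = j := Fin.castSucc_injective _ h1
      subst hij
      have := Sym.oneEquiv.injective ((Sym.cast _).injective (eq_of_heq h2))
      exact congrArg (fun k => Sum.inl (i, k)) this
    · exact absurd (Sigma.mk.inj h).1 (Fin.castSucc_lt_last i).ne
    · exact absurd (Sigma.mk.inj h).1 (Fin.castSucc_lt_last j).ne'
    · have := (Sym2.equivSym _).injective ((Sym.cast _).injective (eq_of_heq (Sigma.mk.inj h).2))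
      rw [this]
  · rintro ⟨i, s⟩
    induction i using Fin.lastCases with
    | last =>
      refine ⟨Sum.inr ((Sym2.equivSym _).symm (Sym.cast (onesTwo_last r) s)), ?_⟩
      simp [toScrollIndex]
    | cast i =>
      refine ⟨Sum.inl (i, Sym.oneEquiv.symm (Sym.cast (onesTwo_castSucc i) s)), ?_⟩
      rw [toScrollIndex, Sum.elim_inl, Equiv.apply_symm_apply]
      simp

lemma scrollMap_toScrollIndex (m r : ℕ) (x : Fin (m + 1) → ℂ) (y : Fin (r + 1) → ℂ) :
    scrollMap m (onesTwo r) x y ∘ toScrollIndex m r =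
      scrollVector (y ∘ Fin.castSucc) (y (Fin.last r)) x := by
  refine formIndex_funext (fun i k => ?_) fun k l => ?_
  · have : ((Sym.oneEquiv k : Sym (Fin (m + 1)) 1) : Multiset (Fin (m + 1))) = {k} := rfl
    simp only [Function.comp_apply, scrollMap, toScrollIndex, Sum.elim_inl, Sym.coe_cast, this,
      Multiset.map_singleton, Multiset.prod_singleton, scrollVector_inl]
  · have : ((Sym2.equivSym _ s(k, l) : Sym (Fin (m + 1)) 2) : Multiset (Fin (m + 1))) = {k, l} := rfl
    simp [scrollMap, toScrollIndex, this]

/-- The change of coordinates from `FormIndex` to `ScrollIndex`. -/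
noncomputable def scrollCoordinates (m r : ℕ) :
    (FormIndex (Fin r) (Fin (m + 1)) → ℂ) ≃ₗ[ℂ] (ScrollIndex m (onesTwo r) → ℂ) :=
  (LinearEquiv.funCongrLeft ℂ ℂ (Equiv.ofBijective _ (toScrollIndex_bijective m r))).symm

lemma scrollCoordinates_scrollVector (m r : ℕ) (x : Fin (m + 1) → ℂ) (y : Fin (r + 1) → ℂ) :
    scrollCoordinates m r (scrollVector (y ∘ Fin.castSucc) (y (Fin.last r)) x) =
      scrollMap m (onesTwo r) x y := by
  rw [scrollCoordinates, LinearEquiv.symm_apply_eq, ← scrollMap_toScrollIndex]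
  rfl

lemma cone_scroll (m r : ℕ) : cone (scroll m (onesTwo r)) =
    scrollCoordinates m r '' scrollCone (Fin r) (Fin (m + 1)) := by
  ext v
  constructor
  · rintro ⟨hv, x, y, h, hx, hvx⟩
    obtain ⟨a, ha⟩ := (Projectivization.mk_eq_mk_iff' ℂ _ _ hv h).1 hvx
    have hv' : v = scrollMap m (onesTwo r) x (a • y) := by
      rw [← ha]
      ext c
      simp [scrollMap, mul_assoc]
    refine ⟨_, ⟨?_, (a • y) ∘ Fin.castSucc, (a • y) (Fin.last r), x, rfl⟩, ?_⟩
    · intro h0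
      apply hv
      rw [hv', ← scrollCoordinates_scrollVector, h0, map_zero]
    · rw [scrollCoordinates_scrollVector, hv']
  · rintro ⟨_, ⟨h0, y, t, x, rfl⟩, rfl⟩
    have hsnoc : scrollVector y t x = scrollVector
        ((Fin.snoc y t : Fin (r + 1) → ℂ) ∘ Fin.castSucc) ((Fin.snoc y t : Fin (r + 1) → ℂ)
          (Fin.last r)) x := by
      congr
      · ext i
        simp
      · simp
    have hne := (scrollCoordinates m r).map_ne_zero_iff.2 h0
    refine ⟨hne, x, Fin.snoc y t, ?_, ?_, ?_⟩
    · rwa [← scrollCoordinates_scrollVector, ← hsnoc]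
    · rintro rfl
      exact h0 (formIndex_funext (fun i k => by simp) fun k l => by simp)
    · congr 1
      rw [← scrollCoordinates_scrollVector, ← hsnoc]

theorem isIrreducibleHypersurface_dualVariety_scroll {m r : ℕ} (hrm : r ≤ m) :
    IsIrreducibleHypersurface (dualVariety (scroll m (onesTwo r))) (m + r + 1) := by
  have := isIrreducibleHypersurface_of_cone_eq (r := r) (n := m + 1) (by omega)
    (scrollCoordinates m r) (cone_scroll m r)
  rwa [show m + 1 + r = m + r + 1 by omega] at this

end Scroll

/-! ### Plücker degree of polynomial curves, and lines in a Grassmannian. -/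

section Curves

variable {k n : ℕ}

/-- The matrix whose columns are the coordinates of linear forms. -/
def formMatrix (f : Fin k → (Fin n → ℂ) →ₗ[ℂ] ℂ) : Matrix (Fin n) (Fin k) ℂ :=
  Matrix.of fun l j => f j (Pi.single l 1)

lemma eval_mul_formMatrix (M : Matrix (Fin k) (Fin n) (Polynomial ℂ))
    (f : Fin k → (Fin n → ℂ) →ₗ[ℂ] ℂ) (s : ℂ) (i j : Fin k) :
    ((M * (formMatrix f).map Polynomial.C) i j).eval s = f j (fun l => (M i l).eval s) := by
  rw [LinearMap.pi_apply_eq_sum_univ (f j), Matrix.mul_apply, Polynomial.eval_finsetSum]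
  refine Finset.sum_congr rfl fun l _ => ?_
  have : (Pi.single l 1 : Fin n → ℂ) = fun j => if l = j then 1 else 0 := by
    ext j
    simp [Pi.single_apply, eq_comm]
  simp [formMatrix, this]

lemma eval_derivative_mul_formMatrix (M : Matrix (Fin k) (Fin n) (Polynomial ℂ))
    (f : Fin k → (Fin n → ℂ) →ₗ[ℂ] ℂ) (s : ℂ) (i j : Fin k) :
    ((M * (formMatrix f).map Polynomial.C) i j).derivative.eval s =
      f j (fun l => (M i l).derivative.eval s) := by
  have := eval_mul_formMatrix (Matrix.of fun i l => (M i l).derivative) f s i j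
  simp only [Matrix.mul_apply, Matrix.of_apply] at this
  rw [← this]
  congr 1
  simp [Matrix.mul_apply]

/-- A multilinear form of Cauchy–Binet: the determinant is a constant combination of the `k × k`
minors, so the Plücker degree bounds it for any choice of linear forms. -/
lemma det_mul_map_C (M : Matrix (Fin k) (Fin n) (Polynomial ℂ)) (N : Matrix (Fin n) (Fin k) ℂ) :
    (M * N.map Polynomial.C).det =
      ∑ e : Fin k → Fin n, Polynomial.C (∏ j, N (e j) j) * (M.submatrix id e).det := by
  simp only [Matrix.det_apply', Matrix.mul_apply, Finset.prod_univ_sum, Finset.mul_sum,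
    Fintype.piFinset_univ]
  rw [Finset.sum_comm]
  refine Finset.sum_congr rfl fun e _ => Finset.sum_congr rfl fun σ _ => ?_
  simp only [Finset.prod_mul_distrib, Matrix.map_apply, Matrix.submatrix_apply, id, map_prod]
  ring

lemma natDegree_det_mul_map_C_le (M : Matrix (Fin k) (Fin n) (Polynomial ℂ))
    (N : Matrix (Fin n) (Fin k) ℂ) :
    (M * N.map Polynomial.C).det.natDegree ≤ pluckerDegree M := by
  rw [det_mul_map_C]
  refine Polynomial.natDegree_sum_le_of_forall_le _ _ fun e _ => ?_
  exact (Polynomial.natDegree_C_mul_le _ _).trans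
    (Finset.le_sup (f := fun e : Fin k → Fin n => (M.submatrix id e).det.natDegree)
      (Finset.mem_univ e))

lemma natDegree_det_le {ι : Type} [Fintype ι] [DecidableEq ι] (A : Matrix ι ι (Polynomial ℂ))
    (d : ι → ℕ) (hd : ∀ i j, (A i j).natDegree ≤ d j) : A.det.natDegree ≤ ∑ j, d j := by
  rw [Matrix.det_apply]
  refine Polynomial.natDegree_sum_le_of_forall_le _ _ fun σ _ => ?_
  have h : (∏ j, A (σ j) j).natDegree ≤ ∑ j, d j :=
    (Polynomial.natDegree_prod_le _ _).trans (Finset.sum_le_sum fun j _ => hd _ _)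
  rcases Int.units_eq_one_or (Equiv.Perm.sign σ) with h' | h' <;> rw [h']
  · rwa [one_smul]
  · rwa [Units.neg_smul, one_smul, Polynomial.natDegree_neg]

lemma exists_eq_smulRight_of_proportional {W : Type} [AddCommGroup W] [Module ℂ W] {U : Type}
    [AddCommGroup U] [Module ℂ U] {ι : Type} [Finite ι] (w : Module.Basis ι ℂ W) (φ : W →ₗ[ℂ] U)
    (h : ∀ i j, ¬ LinearIndependent ℂ ![φ (w i), φ (w j)]) :
    ∃ (ℓ : W →ₗ[ℂ] ℂ) (u : U), φ = ℓ.smulRight u := by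
  by_cases h0 : ∃ i, φ (w i) ≠ 0
  · obtain ⟨i, hi⟩ := h0
    have hex : ∀ j, ∃ a : ℂ, a • φ (w i) = φ (w j) := fun j => by
      by_contra hne
      push Not at hne
      exact h i j ((LinearIndependent.pair_iff' hi).2 hne)
    choose a ha using hex
    exact ⟨w.constr ℂ a, φ (w i), w.ext fun j => by simp [ha]⟩
  · push Not at h0
    exact ⟨0, 0, w.ext fun j => by simp [h0]⟩

lemma exists_basis_of_curvePoint_eq {W : Submodule ℂ (Fin n → ℂ)} (hW : Module.finrank ℂ W = k)
    {M : Matrix (Fin k) (Fin n) (Polynomial ℂ)} (hM : curvePoint M 0 = W) :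
    ∃ w : Module.Basis (Fin k) ℂ W, ∀ i, (w i : Fin n → ℂ) = fun j => (M i j).eval 0 := by
  have hmem : ∀ i, (fun j => (M i j).eval 0) ∈ W := fun i =>
    hM ▸ Submodule.subset_span ⟨i, rfl⟩
  have hli : LinearIndependent ℂ fun i => (fun j => (M i j).eval 0 : Fin n → ℂ) := by
    rw [linearIndependent_iff_card_eq_finrank_span, Fintype.card_fin]
    refine hW.symm.trans ?_
    rw [← hM]
    rfl
  have hli' : LinearIndependent ℂ fun i => (⟨_, hmem i⟩ : W) :=
    LinearIndependent.of_comp W.subtype hli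
  rcases k with _ | k
  · have : Subsingleton W := Module.finrank_zero_iff.1 hW
    exact ⟨Module.Basis.empty W, fun i => i.elim0⟩
  · exact ⟨basisOfLinearIndependentOfCardEqFinrank hli' (by simp [hW]), fun i => by simp⟩

/-- The velocity of a curve of degree at most one in a Grassmannian has rank at most one. -/
lemma exists_eq_smulRight_of_pluckerDegree_le_one {W : Submodule ℂ (Fin n → ℂ)}
    (hW : Module.finrank ℂ W = k) {M : Matrix (Fin k) (Fin n) (Polynomial ℂ)}
    (hM : curvePoint M 0 = W) (hdeg : pluckerDegree M ≤ 1)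
    {φ : W →ₗ[ℂ] ((Fin n → ℂ) ⧸ W)} (hφ : IsVelocity W M φ) :
    ∃ (ℓ : W →ₗ[ℂ] ℂ) (u : (Fin n → ℂ) ⧸ W), φ = ℓ.smulRight u := by
  obtain ⟨w, hw⟩ := exists_basis_of_curvePoint_eq hW hM
  refine exists_eq_smulRight_of_proportional w φ fun p q hpq => ?_
  have hpq_ne : p ≠ q := by
    rintro rfl
    exact absurd (hpq.injective.ne (show (0 : Fin 2) ≠ 1 by simp)) (by simp)
  obtain ⟨g, hg⟩ := (Fintype.linearCombination ℂ ![φ (w p), φ (w q)]).exists_leftInverse_of_injective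
    (LinearMap.ker_eq_bot.2 hpq.fintypeLinearCombination_injective)
  have hgp : g (φ (w p)) = ![1, 0] := by
    have := LinearMap.congr_fun hg ![1, 0]
    simpa [Fintype.linearCombination_apply] using this
  have hgq : g (φ (w q)) = ![0, 1] := by
    have := LinearMap.congr_fun hg ![0, 1]
    simpa [Fintype.linearCombination_apply] using this
  obtain ⟨ρ, hρ⟩ := W.subtype.exists_leftInverse_of_injective W.ker_subtype
  have hρw : ∀ i, ρ (w i) = w i := fun i => LinearMap.congr_fun hρ (w i)
  -- If `φ (w p)` and `φ (w q)` are independent, forms vanishing on `W` and dual to them replace the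
  -- coordinates `p` and `q`. Columns `p` and `q` of `A` then vanish at `s = 0`, so `s²` divides
  -- `A.det`.
  let f : Fin k → (Fin n → ℂ) →ₗ[ℂ] ℂ := fun j =>
    if j = p then LinearMap.proj 0 ∘ₗ g ∘ₗ W.mkQ else
    if j = q then LinearMap.proj 1 ∘ₗ g ∘ₗ W.mkQ else w.coord j ∘ₗ ρ
  let A := M * (formMatrix f).map Polynomial.C
  have hA0 : ∀ i j, (A i j).eval 0 = f j (w i) := fun i j => by
    rw [eval_mul_formMatrix, hw]
  have hA1 : ∀ i j, (A i j).derivative.eval 0 = f j (fun l => (M i l).derivative.eval 0) :=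
    fun i j => eval_derivative_mul_formMatrix M f 0 i j
  have hφw : ∀ i, W.mkQ (fun l => (M i l).derivative.eval 0) = φ (w i) := fun i =>
    (hφ i (w i) (hw i)).symm
  have hzero : ∀ i, (Submodule.Quotient.mk (w i : Fin n → ℂ) : (Fin n → ℂ) ⧸ W) = 0 :=
    fun i => (Submodule.Quotient.mk_eq_zero W).2 (w i).2
  let Q : Matrix (Fin k) (Fin k) (Polynomial ℂ) := Matrix.of fun i j =>
    if j = p ∨ j = q then (A i j).divX else A i j
  have hAQ : A = Q * Matrix.diagonal (fun j => if j = p ∨ j = q then Polynomial.X else 1) := by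
    ext1 i j
    rw [Matrix.mul_diagonal]
    by_cases hj : j = p ∨ j = q
    · have h0 : (A i j).coeff 0 = 0 := by
        rw [Polynomial.coeff_zero_eq_eval_zero, hA0]
        rcases hj with rfl | rfl
        · simp [f, hzero]
        · simp [f, hpq_ne.symm, hzero]
      conv_lhs => rw [← Polynomial.divX_mul_X_add (A i j), h0, Polynomial.C_0, add_zero]
      simp [Q, hj]
    · simp [Q, hj]
  have hdetA : A.det = Q.det * Polynomial.X ^ 2 := by
    rw [hAQ, Matrix.det_mul, Matrix.det_diagonal, Finset.prod_eq_mul p q hpq_ne]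
    · simp [sq]
    · intro j _ hj
      simp [hj.1, hj.2]
    · simp
    · simp
  have hQ : Q.det = 0 := by
    by_contra hne
    have h1 : A.det.natDegree ≤ 1 := (natDegree_det_mul_map_C_le M _).trans hdeg
    rw [hdetA, Polynomial.natDegree_mul_X_pow _ hne] at h1
    omega
  -- Degree at most one forces `Q.det = 0`. Yet at `0` the matrix `Q` has identity columns outside
  -- `p, q` and an identity `2 × 2` block on rows and columns `p, q`, so its left kernel is zero, a
  -- contradiction.
  have hD : (Q.map (Polynomial.eval 0)).det = 0 := by
    have := congrArg (Polynomial.evalRingHom 0) hQ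
    rwa [RingHom.map_det, map_zero] at this
  obtain ⟨c, hc0, hc⟩ := Matrix.exists_vecMul_eq_zero_iff.2 hD
  have hDp : ∀ i, (Q i p).eval 0 = g (φ (w i)) 0 := fun i => by
    have : (Q i p).eval 0 = (A i p).derivative.eval 0 := by
      simp [Q, ← Polynomial.coeff_zero_eq_eval_zero, Polynomial.coeff_derivative]
    rw [this, hA1, ← hφw]
    simp [f]
  have hDq : ∀ i, (Q i q).eval 0 = g (φ (w i)) 1 := fun i => by
    have : (Q i q).eval 0 = (A i q).derivative.eval 0 := by
      simp [Q, ← Polynomial.coeff_zero_eq_eval_zero, Polynomial.coeff_derivative]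
    rw [this, hA1, ← hφw]
    simp [f, hpq_ne.symm]
  have hDj : ∀ i j, j ≠ p → j ≠ q → (Q i j).eval 0 = if i = j then 1 else 0 := fun i j h1 h2 => by
    simp [Q, h1, h2, hA0, f, hρw, Finsupp.single_apply]
  have hcj : ∀ j, j ≠ p → j ≠ q → c j = 0 := fun j h1 h2 => by
    have := congrFun hc j
    simpa [Matrix.vecMul, dotProduct, hDj _ j h1 h2] using this
  have hsum : ∀ F : Fin k → ℂ, ∑ i, c i * F i = c p * F p + c q * F q := fun F =>
    Fintype.sum_eq_add p q hpq_ne fun j hj => by rw [hcj j hj.1 hj.2, zero_mul]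
  have hcp : c p = 0 := by
    have := congrFun hc p
    simpa [Matrix.vecMul, dotProduct, hDp, hsum, hgp, hgq] using this
  have hcq : c q = 0 := by
    have := congrFun hc q
    simpa [Matrix.vecMul, dotProduct, hDq, hsum, hgp, hgq] using this
  refine hc0 (funext fun j => ?_)
  by_cases h1 : j = p
  · rw [h1, hcp]; rfl
  by_cases h2 : j = q
  · rw [h2, hcq]; rfl
  exact hcj j h1 h2

/-- The line with rows `w_i + s ℓ(w_i) v`. -/
noncomputable def lineMatrix {W : Submodule ℂ (Fin n → ℂ)} (w : Fin k → W) (ℓ : W →ₗ[ℂ] ℂ)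
    (v : Fin n → ℂ) : Matrix (Fin k) (Fin n) (Polynomial ℂ) :=
  Matrix.of fun i l => Polynomial.C ((w i : Fin n → ℂ) l) +
    Polynomial.X * Polynomial.C (ℓ (w i) * v l)

lemma eval_lineMatrix {W : Submodule ℂ (Fin n → ℂ)} (w : Fin k → W) (ℓ : W →ₗ[ℂ] ℂ)
    (v : Fin n → ℂ) (s : ℂ) (i : Fin k) :
    (fun l => (lineMatrix w ℓ v i l).eval s) = (W.subtype + s • ℓ.smulRight v) (w i) := by
  ext l
  simp [lineMatrix]

lemma pluckerDegree_lineMatrix_le {W : Submodule ℂ (Fin n → ℂ)} (w : Fin k → W) (ℓ : W →ₗ[ℂ] ℂ)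
    (v : Fin n → ℂ) : pluckerDegree (lineMatrix w ℓ v) ≤ 1 := by
  refine Finset.sup_le fun e _ => ?_
  have hblock : (lineMatrix w ℓ v).submatrix id e =
      (Matrix.of fun i j => Polynomial.C ((w i : Fin n → ℂ) (e j))) -
        (Matrix.of fun i (_ : Unit) => Polynomial.X * Polynomial.C (ℓ (w i))) *
        (Matrix.of fun (_ : Unit) j => - Polynomial.C (v (e j))) := by
    ext1 i j
    simp [lineMatrix, Matrix.mul_apply, mul_assoc]
    ring
  -- A rank-one perturbation is a Schur complement: after bordering, a single column involves `s`,
  -- and it does so linearly.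
  rw [hblock, ← Matrix.det_fromBlocks_one₂₂]
  refine (natDegree_det_le _ (Sum.elim 0 1) ?_).trans (by simp)
  rintro (i | _) (j | _)
  · simp
  · simp only [Matrix.fromBlocks_apply₁₂, Matrix.of_apply, Sum.elim_inr, Pi.one_apply]
    exact Polynomial.natDegree_mul_le_of_le (m := 1) (n := 0) (by simp) (by simp)
  · simp
  · simp

lemma pluckerDegree_lineMatrix_pos {W : Submodule ℂ (Fin n → ℂ)} (w : Module.Basis (Fin k) ℂ W)
    {ℓ : W →ₗ[ℂ] ℂ} (hℓ : ℓ ≠ 0) {v : Fin n → ℂ} (hv : v ∉ W) :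
    0 < pluckerDegree (lineMatrix w ℓ v) := by
  obtain ⟨p, hp⟩ : ∃ p, ℓ (w p) ≠ 0 := by
    by_contra h
    push Not at h
    exact hℓ (w.ext fun i => by simp [h])
  have hu : (Submodule.Quotient.mk v : (Fin n → ℂ) ⧸ W) ≠ 0 := by simpa using hv
  have hzero : ∀ w : W, (Submodule.Quotient.mk (w : Fin n → ℂ) : (Fin n → ℂ) ⧸ W) = 0 :=
    fun w => (Submodule.Quotient.mk_eq_zero W).2 w.2
  obtain ⟨μ, hμ⟩ : ∃ μ : ((Fin n → ℂ) ⧸ W) →ₗ[ℂ] ℂ, μ (Submodule.Quotient.mk v) = 1 := by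
    exact Module.Projective.exists_dual_eq_one ℂ hu
  obtain ⟨ρ, hρ⟩ := W.subtype.exists_leftInverse_of_injective W.ker_subtype
  have hρw : ∀ w : W, ρ w = w := fun w => LinearMap.congr_fun hρ w
  -- The forms with `j ≠ p` are corrected to vanish on `v`. The resulting minor is the determinant
  -- of the identity with column `p` replaced by `s ℓ(w_i)`; it vanishes at `0` and not at `1`, so
  -- it is not constant.
  let f : Fin k → (Fin n → ℂ) →ₗ[ℂ] ℂ := fun j =>
    if j = p then μ ∘ₗ W.mkQ else
      w.coord j ∘ₗ (ρ - (μ ∘ₗ W.mkQ).smulRight (ρ v))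
  have hentry : ∀ s i j,
      ((lineMatrix w ℓ v * (formMatrix f).map Polynomial.C) i j).eval s =
        if j = p then s * ℓ (w i) else if i = j then 1 else 0 := fun s i j => by
    rw [eval_mul_formMatrix, eval_lineMatrix]
    by_cases hj : j = p
    · simp [f, hj, hμ, hzero]
    · simp [f, hj, hμ, hρw, hzero, Finsupp.single_apply]
      ring
  by_contra hdeg
  have hdeg' := natDegree_det_mul_map_C_le (lineMatrix w ℓ v) (formMatrix f)
  have hconst := Polynomial.eq_C_of_natDegree_eq_zero
    (show (lineMatrix w ℓ v * (formMatrix f).map Polynomial.C).det.natDegree = 0 by omega)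
  have heval : ∀ s, (lineMatrix w ℓ v * (formMatrix f).map Polynomial.C).det.eval s =
      (Matrix.of fun i j => if j = p then s * ℓ (w i) else if i = j then 1 else 0).det := fun s => by
    rw [← Polynomial.coe_evalRingHom, RingHom.map_det]
    congr 1
    ext i j
    exact hentry s i j
  have h0 : (lineMatrix w ℓ v * (formMatrix f).map Polynomial.C).det.eval 0 = 0 := by
    rw [heval]
    exact Matrix.det_eq_zero_of_column_eq_zero p fun i => by simp
  have h1 : (lineMatrix w ℓ v * (formMatrix f).map Polynomial.C).det.eval 1 ≠ 0 := by
    rw [heval]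
    intro hdet
    obtain ⟨c, hc0, hc⟩ := Matrix.exists_vecMul_eq_zero_iff.2 hdet
    have hcj : ∀ j, j ≠ p → c j = 0 := fun j hj => by
      have := congrFun hc j
      simpa [Matrix.vecMul, dotProduct, hj] using this
    have hcp : c p = 0 := by
      have := congrFun hc p
      simp only [Matrix.vecMul, dotProduct, Matrix.of_apply, if_true, one_mul] at this
      rw [Finset.sum_eq_single p (fun j _ hj => by rw [hcj j hj, zero_mul]) (by simp)] at this
      exact (mul_eq_zero.1 this).resolve_right hp
    refine hc0 (funext fun j => ?_)
    by_cases hj : j = p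
    · rw [hj, hcp]; rfl
    · exact hcj j hj
  rw [hconst, Polynomial.eval_C] at h0 h1
  exact h1 h0

end Curves

/-! ### Tangent spaces and minimal rational tangents of isotropic Grassmannians. -/

section Tangent

variable {k n : ℕ} {Ω : Matrix (Fin n) (Fin n) ℂ} {W : Submodule ℂ (Fin n → ℂ)}

lemma dotProduct_mulVec_swap (hΩ : Ω.transpose = -Ω) (u v : Fin n → ℂ) :
    u ⬝ᵥ (Ω *ᵥ v) = - (v ⬝ᵥ (Ω *ᵥ u)) := by
  rw [Matrix.dotProduct_mulVec, ← Matrix.mulVec_transpose, hΩ, Matrix.neg_mulVec, neg_dotProduct,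
    dotProduct_comm]

lemma dotProduct_mulVec_self (hΩ : Ω.transpose = -Ω) (v : Fin n → ℂ) : v ⬝ᵥ (Ω *ᵥ v) = 0 := by
  have := dotProduct_mulVec_swap hΩ v v
  linear_combination (1 / 2 : ℂ) * this

/-- The pairing of `ℂ^n / W` with an isotropic subspace `W` given by the bilinear form. -/
noncomputable def quotientPairing (hW : W ∈ isotropicGrassmannian k Ω) :
    ((Fin n → ℂ) ⧸ W) →ₗ[ℂ] W →ₗ[ℂ] ℂ :=
  W.liftQ ((Matrix.toBilin' Ω).compl₂ W.subtype) fun u hu => by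
    refine LinearMap.ext fun w => ?_
    simpa [Matrix.toBilin'_apply'] using hW.2 u hu w w.2

@[simp] lemma quotientPairing_mk (hW : W ∈ isotropicGrassmannian k Ω) (u : Fin n → ℂ) (w : W) :
    quotientPairing hW (Submodule.Quotient.mk u) w = u ⬝ᵥ (Ω *ᵥ w) :=
  (LinearMap.congr_fun (Submodule.liftQ_apply W _ u) w).trans (by
    simp [Matrix.toBilin'_apply'])

/-- Since `W` is isotropic, the first-order condition depends on `ψ` only modulo `W`; skew-symmetry
of `Ω` turns it into symmetry of the form `(w, w') ↦ ω(φ w, w')` on `W`. -/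
lemma mem_grassmannianTangentSpace_iff (hΩ : Ω.transpose = -Ω)
    (hW : W ∈ isotropicGrassmannian k Ω) {φ : W →ₗ[ℂ] ((Fin n → ℂ) ⧸ W)} :
    φ ∈ grassmannianTangentSpace Ω W ↔
      ∀ w w' : W, quotientPairing hW (φ w) w' = quotientPairing hW (φ w') w := by
  have key : ∀ ψ : W →ₗ[ℂ] (Fin n → ℂ), ψ ∈ firstOrderDeformations Ω W ↔
      ∀ w w' : W, quotientPairing hW (W.mkQ (ψ w)) w' = quotientPairing hW (W.mkQ (ψ w')) w := by
    intro ψ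
    refine forall₂_congr fun w w' => ?_
    rw [Submodule.mkQ_apply, Submodule.mkQ_apply, quotientPairing_mk, quotientPairing_mk,
      dotProduct_mulVec_swap hΩ w, ← sub_eq_add_neg, sub_eq_zero]
  constructor
  · rintro ⟨ψ, hψ, rfl⟩
    exact (key ψ).1 hψ
  · intro h
    obtain ⟨σ, hσ⟩ := W.mkQ.exists_rightInverse_of_surjective W.range_mkQ
    have hσφ : W.mkQ ∘ₗ (σ ∘ₗ φ) = φ := by rw [← LinearMap.comp_assoc, hσ, LinearMap.id_comp]
    have hσw : ∀ w, W.mkQ ((σ ∘ₗ φ) w) = φ w := fun w => LinearMap.congr_fun hσφ w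
    refine ⟨σ ∘ₗ φ, (key _).2 fun w w' => ?_, hσφ⟩
    rw [hσw, hσw]
    exact h w w'

/-- A nonzero tangent vector of rank one is the velocity of a line. -/
lemma exists_line_of_smulRight (hΩ : Ω.transpose = -Ω) (hW : W ∈ isotropicGrassmannian k Ω)
    {ℓ : W →ₗ[ℂ] ℂ} {u : (Fin n → ℂ) ⧸ W} (h0 : ℓ.smulRight u ≠ 0)
    (hT : ℓ.smulRight u ∈ grassmannianTangentSpace Ω W) :
    ∃ M : Matrix (Fin k) (Fin n) (Polynomial ℂ), IsRationalCurveThrough Ω W M ∧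
      pluckerDegree M = 1 ∧ IsVelocity W M (ℓ.smulRight u) := by
  obtain ⟨v, rfl⟩ := Submodule.Quotient.mk_surjective W u
  have hℓ : ℓ ≠ 0 := by
    rintro rfl
    exact h0 (LinearMap.ext fun w => by simp)
  have hv : v ∉ W := fun hv => h0 <| LinearMap.ext fun w => by
    simp [(Submodule.Quotient.mk_eq_zero W).2 hv]
  let w : Module.Basis (Fin k) ℂ W := Module.finBasisOfFinrankEq ℂ W hW.1
  rw [mem_grassmannianTangentSpace_iff hΩ hW] at hT
  simp only [LinearMap.smulRight_apply, map_smul, LinearMap.smul_apply, quotientPairing_mk,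
    smul_eq_mul] at hT
  have hcurve : ∀ s, curvePoint (lineMatrix w ℓ v) s =
      LinearMap.range (W.subtype + s • ℓ.smulRight v) := fun s => by
    rw [curvePoint, show (fun i => fun j => (lineMatrix w ℓ v i j).eval s) =
      fun i => (W.subtype + s • ℓ.smulRight v) (w i) from funext fun i => eval_lineMatrix w ℓ v s i,
      Set.range_comp' _ w, Submodule.span_image, w.span_eq, Submodule.map_top]
  refine ⟨lineMatrix w ℓ v, ⟨fun s => ⟨?_, ?_⟩, ?_⟩, ?_, ?_⟩
  · rw [hcurve, LinearMap.finrank_range_of_inj, hW.1]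
    rw [← LinearMap.ker_eq_bot, LinearMap.ker_eq_bot']
    intro x hx
    have hx' : (x : Fin n → ℂ) + s • ℓ x • v = 0 := hx
    by_cases hs : s * ℓ x = 0
    · rw [smul_smul, hs, zero_smul, add_zero] at hx'
      exact Subtype.ext hx'
    · refine absurd ?_ hv
      have : v = (-(s * ℓ x)⁻¹) • (x : Fin n → ℂ) := by
        rw [smul_smul] at hx'
        rw [eq_neg_of_add_eq_zero_left hx', neg_smul, smul_neg, neg_neg, smul_smul,
          inv_mul_cancel₀ hs, one_smul]
      rw [this]
      exact W.smul_mem _ x.2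
  · rw [hcurve]
    rintro _ ⟨x, rfl⟩ _ ⟨y, rfl⟩
    have hxy := hT x y
    have h1 := hW.2 x x.2 y y.2
    have h2 := dotProduct_mulVec_self hΩ v
    have h3 := dotProduct_mulVec_swap hΩ (x : Fin n → ℂ) v
    simp only [LinearMap.add_apply, Submodule.subtype_apply, LinearMap.smul_apply,
      LinearMap.smulRight_apply, add_dotProduct, Matrix.mulVec_add, dotProduct_add,
      Matrix.mulVec_smul, smul_dotProduct, dotProduct_smul, smul_eq_mul]
    -- The term in `s²` vanishes because the form is alternating, and the term in `s` because `ℓ ⊗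
    -- v` is tangent.
    linear_combination h1 + s * ℓ x * s * ℓ y * h2 + s * ℓ y * h3 + s * hxy
  · rw [hcurve, zero_smul, add_zero, Submodule.range_subtype]
  · exact le_antisymm (pluckerDegree_lineMatrix_le _ _ _) (pluckerDegree_lineMatrix_pos w hℓ hv)
  · intro i x hx
    have hxw : x = w i := by
      refine Subtype.ext (hx.trans ?_)
      rw [eval_lineMatrix]
      simp
    subst hxw
    have : (fun l => (lineMatrix w ℓ v i l).derivative.eval 0) = ℓ (w i) • v := by
      ext l
      simp [lineMatrix]
    rw [this]
    simp

/-- The minimal rational tangents are the tangent directions of rank one, provided that there is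
one. -/
lemma mk_mem_minimalRationalTangents_iff (hΩ : Ω.transpose = -Ω)
    (hW : W ∈ isotropicGrassmannian k Ω)
    (hex : ∃ φ ∈ grassmannianTangentSpace Ω W, φ ≠ 0 ∧
      ∃ (ℓ : W →ₗ[ℂ] ℂ) (u : (Fin n → ℂ) ⧸ W), φ = ℓ.smulRight u)
    {φ : grassmannianTangentSpace Ω W} (hφ : φ ≠ 0) :
    Projectivization.mk ℂ φ hφ ∈ minimalRationalTangents k Ω W ↔
      ∃ (ℓ : W →ₗ[ℂ] ℂ) (u : (Fin n → ℂ) ⧸ W), φ.1 = ℓ.smulRight u := by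
  constructor
  · rintro ⟨M, φ', h', ⟨hM, hpos, hmin⟩, hvel, heq⟩
    obtain ⟨φ₀, hφ₀T, hφ₀, ℓ₀, u₀, rfl⟩ := hex
    obtain ⟨M₀, hM₀, hdeg₀, -⟩ := exists_line_of_smulRight hΩ hW hφ₀ hφ₀T
    have hdeg : pluckerDegree M ≤ 1 := by
      -- Comparison with the line given by `hex` bounds the minimal degree by one.
      have := hmin M₀ hM₀ (by omega)
      omega
    obtain ⟨ℓ, u, hℓu⟩ := exists_eq_smulRight_of_pluckerDegree_le_one hW.1 hM.2 hdeg hvel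
    obtain ⟨a, rfl⟩ := (Projectivization.mk_eq_mk_iff' ℂ _ _ hφ h').1 heq
    refine ⟨ℓ, a • u, ?_⟩
    rw [Submodule.coe_smul, hℓu]
    ext w
    simp [smul_comm a]
  · rintro ⟨ℓ, u, hℓu⟩
    obtain ⟨M, hM, hdeg, hvel⟩ := exists_line_of_smulRight hΩ hW (ℓ := ℓ) (u := u)
      (fun h => hφ (Subtype.ext (hℓu.trans h))) (hℓu ▸ φ.2)
    exact ⟨M, φ, hφ, ⟨hM, by omega, fun M' _ h' => by omega⟩, hℓu ▸ hvel, rfl⟩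

/-- If `W` does not meet the kernel of the form, the pairing of `ℂ^n / W` with `W` is surjective. -/
lemma quotientPairing_surjective (hW : W ∈ isotropicGrassmannian k Ω)
    (hK : LinearMap.ker Ω.mulVecLin ⊓ W = ⊥) : Function.Surjective (quotientPairing hW) := by
  rw [← LinearMap.flip_injective_iff₁, ← LinearMap.ker_eq_bot, LinearMap.ker_eq_bot']
  intro w hw
  have : (w : Fin n → ℂ) ∈ LinearMap.ker Ω.mulVecLin ⊓ W := by
    refine ⟨?_, w.2⟩
    change Ω *ᵥ (w : Fin n → ℂ) = 0
    refine dotProduct_eq_zero _ fun u => ?_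
    have := LinearMap.congr_fun hw (Submodule.Quotient.mk u)
    rw [dotProduct_comm]
    simpa using this
  rw [hK, Submodule.mem_bot] at this
  exact Subtype.ext this

/-- Coordinates on `ℂ^n / W`: the pairing with a basis of `W`, and one more linear form. -/
lemma exists_quotientCoordinates (hW : W ∈ isotropicGrassmannian k Ω)
    (hK : LinearMap.ker Ω.mulVecLin ⊓ W = ⊥) (hn : n = 2 * k + 1)
    (w : Module.Basis (Fin k) ℂ W) :
    ∃ Θ : ((Fin n → ℂ) ⧸ W) ≃ₗ[ℂ] ℂ × (Fin k → ℂ),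
      ∀ u j, (Θ u).2 j = quotientPairing hW u (w j) := by
  have hquot : Module.finrank ℂ ((Fin n → ℂ) ⧸ W) = k + 1 := by
    have := W.finrank_quotient_add_finrank
    rw [hW.1, Module.finrank_fin_fun] at this
    omega
  have hdual : Module.finrank ℂ (W →ₗ[ℂ] ℂ) = k := by
    rw [Module.finrank_linearMap, hW.1, Module.finrank_self, mul_one]
  have hker : Module.finrank ℂ (LinearMap.ker (quotientPairing hW)) = Module.finrank ℂ ℂ := by
    have := LinearMap.finrank_range_add_finrank_ker (quotientPairing hW)
    rw [LinearMap.range_eq_top.2 (quotientPairing_surjective hW hK), finrank_top, hdual,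
      hquot] at this
    rw [Module.finrank_self]
    omega
  obtain ⟨e⟩ := FiniteDimensional.nonempty_linearEquiv_of_finrank_eq hker
  -- By dimensions the pairing has a one-dimensional kernel; `κ` is a linear form on the quotient
  -- that is nonzero there.
  obtain ⟨κ, hκ⟩ := LinearMap.exists_extend e.toLinearMap
  let Θ : ((Fin n → ℂ) ⧸ W) →ₗ[ℂ] ℂ × (Fin k → ℂ) :=
    κ.prod (LinearMap.pi fun j => (quotientPairing hW).flip (w j))
  have hinj : Function.Injective Θ := by
    rw [← LinearMap.ker_eq_bot, LinearMap.ker_eq_bot']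
    intro u hu
    have hu1 : κ u = 0 := congrArg Prod.fst hu
    have hu2 : u ∈ LinearMap.ker (quotientPairing hW) :=
      LinearMap.mem_ker.2 (w.ext fun j => congrFun (congrArg Prod.snd hu) j)
    have : e ⟨u, hu2⟩ = 0 := by
      rw [← hu1]
      exact (LinearMap.congr_fun hκ ⟨u, hu2⟩).symm
    exact congrArg Subtype.val (e.map_eq_zero_iff.1 this)
  exact ⟨LinearEquiv.ofInjectiveOfFinrankEq Θ hinj (by simp [hquot, add_comm]), fun u j => rfl⟩

/-- The tangent vector with given coordinates. -/
noncomputable def tangentOfForm (w : Module.Basis (Fin k) ℂ W)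
    (Θ : ((Fin n → ℂ) ⧸ W) ≃ₗ[ℂ] ℂ × (Fin k → ℂ)) :
    (FormIndex (Fin 1) (Fin k) → ℂ) →ₗ[ℂ] (W →ₗ[ℂ] ((Fin n → ℂ) ⧸ W)) :=
  (w.constr ℂ).toLinearMap ∘ₗ LinearMap.pi fun i => Θ.symm.toLinearMap ∘ₗ
    (LinearMap.proj (Sum.inl (0, i))).prod (LinearMap.pi fun j => LinearMap.proj (Sum.inr s(i, j)))

lemma tangentOfForm_basis (w : Module.Basis (Fin k) ℂ W)
    (Θ : ((Fin n → ℂ) ⧸ W) ≃ₗ[ℂ] ℂ × (Fin k → ℂ)) (h : FormIndex (Fin 1) (Fin k) → ℂ)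
    (i : Fin k) :
    Θ (tangentOfForm w Θ h (w i)) = (h (Sum.inl (0, i)), fun j => h (Sum.inr s(i, j))) := by
  simp [tangentOfForm]
  rfl

lemma exists_tangentCoordinates (hΩ : Ω.transpose = -Ω) (hW : W ∈ isotropicGrassmannian k Ω)
    (w : Module.Basis (Fin k) ℂ W) (Θ : ((Fin n → ℂ) ⧸ W) ≃ₗ[ℂ] ℂ × (Fin k → ℂ))
    (hΘ : ∀ u j, (Θ u).2 j = quotientPairing hW u (w j)) :
    ∃ G : (FormIndex (Fin 1) (Fin k) → ℂ) ≃ₗ[ℂ] grassmannianTangentSpace Ω W,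
      ∀ h, (G h).1 = tangentOfForm w Θ h := by
  have hpair : ∀ φ : W →ₗ[ℂ] ((Fin n → ℂ) ⧸ W), φ ∈ grassmannianTangentSpace Ω W ↔
      ∀ i j, (Θ (φ (w i))).2 j = (Θ (φ (w j))).2 i := by
    intro φ
    rw [mem_grassmannianTangentSpace_iff hΩ hW]
    refine ⟨fun h i j => by rw [hΘ, hΘ]; exact h _ _, fun h => ?_⟩
    have : quotientPairing hW ∘ₗ φ = (quotientPairing hW ∘ₗ φ).flip :=
      w.ext fun i => w.ext fun j => by
        have := h i j
        rw [hΘ, hΘ] at this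
        exact this
    exact fun x y => LinearMap.congr_fun₂ this x y
  let G := (tangentOfForm w Θ).codRestrict (grassmannianTangentSpace Ω W) fun h =>
    (hpair _).2 fun i j => by
      rw [tangentOfForm_basis, tangentOfForm_basis]
      exact congrArg (fun s => h (Sum.inr s)) Sym2.eq_swap
  refine ⟨LinearEquiv.ofBijective G ⟨fun h h' hh => ?_, fun φ => ?_⟩, fun h => rfl⟩
  · have hG : tangentOfForm w Θ h = tangentOfForm w Θ h' := congrArg Subtype.val hh
    have key : ∀ i, (h (Sum.inl (0, i)), fun j => h (Sum.inr s(i, j))) =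
        (h' (Sum.inl (0, i)), fun j => h' (Sum.inr s(i, j))) := fun i => by
      rw [← tangentOfForm_basis w Θ, hG, tangentOfForm_basis]
    refine formIndex_funext (fun i j => ?_) fun i j => congrFun (congrArg Prod.snd (key i)) j
    rw [Subsingleton.elim i 0]
    exact congrArg Prod.fst (key j)
  · refine ⟨Sum.elim (fun p => (Θ (φ.1 (w p.2))).1) (Sym2.lift ⟨fun i j => (Θ (φ.1 (w i))).2 j,
      (hpair _).1 φ.2⟩), Subtype.ext (w.ext fun i => Θ.injective ?_)⟩
    exact tangentOfForm_basis w Θ _ i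

/-- For `φ = ℓ ⊗ u` the symmetric part `ℓ_i u_j` must be symmetric, which forces the `W*`-component
of `u` to be a multiple `t ℓ`. This leaves the vectors `(y ℓ, t ℓ²)`. -/
lemma tangentOfForm_eq_smulRight_iff (w : Module.Basis (Fin k) ℂ W)
    (Θ : ((Fin n → ℂ) ⧸ W) ≃ₗ[ℂ] ℂ × (Fin k → ℂ)) {h : FormIndex (Fin 1) (Fin k) → ℂ}
    (h0 : h ≠ 0) : (∃ (ℓ : W →ₗ[ℂ] ℂ) (u : (Fin n → ℂ) ⧸ W), tangentOfForm w Θ h = ℓ.smulRight u) ↔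
      h ∈ scrollCone (Fin 1) (Fin k) := by
  constructor
  · rintro ⟨ℓ, u, hℓ⟩
    have key : ∀ i, (h (Sum.inl (0, i)), fun j => h (Sum.inr s(i, j))) = ℓ (w i) • Θ u :=
      fun i => by rw [← tangentOfForm_basis w Θ, hℓ, LinearMap.smulRight_apply, map_smul]
    have h1 : ∀ a i, h (Sum.inl (a, i)) = ℓ (w i) * (Θ u).1 := fun a i => by
      rw [Subsingleton.elim a 0]
      exact congrArg Prod.fst (key i)
    have h2 : ∀ i j, h (Sum.inr s(i, j)) = ℓ (w i) * (Θ u).2 j := fun i j =>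
      congrFun (congrArg Prod.snd (key i)) j
    obtain ⟨p, hp⟩ : ∃ p, ℓ (w p) ≠ 0 := by
      by_contra hne
      push Not at hne
      exact h0 (formIndex_funext (fun a i => by simp [h1, hne]) fun i j => by simp [h2, hne])
    refine ⟨h0, fun _ => (Θ u).1, (Θ u).2 p / ℓ (w p), fun i => ℓ (w i),
      formIndex_funext (fun a i => ?_) fun i j => ?_⟩
    · rw [h1, scrollVector_inl, mul_comm]
    · have h3 : ℓ (w p) * (Θ u).2 j = ℓ (w j) * (Θ u).2 p := by
        rw [← h2, ← h2, Sym2.eq_swap]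
      rw [h2, scrollVector_inr]
      field_simp
      linear_combination ℓ (w i) * h3
  · rintro ⟨-, y, t, x, rfl⟩
    refine ⟨w.constr ℂ x, Θ.symm (y 0, t • x), w.ext fun i => Θ.injective ?_⟩
    rw [tangentOfForm_basis]
    ext
    · simp [mul_comm]
    · simp
      ring

/-- The variety of minimal rational tangents of the odd Lagrangian Grassmannian is linearly
equivalent to the scroll of type `(1, 2)`. -/
theorem exists_cone_vmrt_eq {m d : ℕ} (hm : 1 ≤ m) {Ω : Matrix (Fin (2 * m + 1)) (Fin (2 * m + 1)) ℂ}
    (hΩ : Ω.transpose = -Ω) (hrank : Ω.rank = 2 * m)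
    {W : Submodule ℂ (Fin (2 * m + 1) → ℂ)} (hW : W ∈ isotropicGrassmannian m Ω)
    (hKW : ¬ LinearMap.ker Ω.mulVecLin ≤ W)
    (b : Module.Basis (Fin d) ℂ (grassmannianTangentSpace Ω W)) :
    ∃ L : (FormIndex (Fin 1) (Fin m) → ℂ) ≃ₗ[ℂ] (Fin d → ℂ),
      cone (vmrt m Ω W b) = L '' scrollCone (Fin 1) (Fin m) := by
  -- The kernel of the form is a line, so not being contained in `W` means meeting `W` trivially.
  have hK : LinearMap.ker Ω.mulVecLin ⊓ W = ⊥ := by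
    have h1 := LinearMap.finrank_range_add_finrank_ker Ω.mulVecLin
    rw [Module.finrank_fin_fun] at h1
    have h2 : Module.finrank ℂ (LinearMap.ker Ω.mulVecLin) = 1 := by
      rw [Matrix.rank] at hrank
      omega
    by_contra hne
    refine hKW (inf_eq_left.1 (Submodule.eq_of_le_of_finrank_le inf_le_left ?_))
    rw [h2]
    exact Submodule.one_le_finrank_iff.2 hne
  let w : Module.Basis (Fin m) ℂ W := Module.finBasisOfFinrankEq ℂ W hW.1
  obtain ⟨Θ, hΘ⟩ := exists_quotientCoordinates hW hK rfl w
  obtain ⟨G, hG⟩ := exists_tangentCoordinates hΩ hW w Θ hΘ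
  have hrk : ∀ h : FormIndex (Fin 1) (Fin m) → ℂ, h ≠ 0 →
      ((∃ (ℓ : W →ₗ[ℂ] ℂ) (u : (Fin (2 * m + 1) → ℂ) ⧸ W), (G h).1 = ℓ.smulRight u) ↔
        h ∈ scrollCone (Fin 1) (Fin m)) := fun h h0 => by
    rw [hG]
    exact tangentOfForm_eq_smulRight_iff w Θ h0
  have hex : ∃ φ ∈ grassmannianTangentSpace Ω W, φ ≠ 0 ∧
      ∃ (ℓ : W →ₗ[ℂ] ℂ) (u : (Fin (2 * m + 1) → ℂ) ⧸ W), φ = ℓ.smulRight u := by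
    have hne : (scrollVector (fun _ => 1) 0 (fun _ => 1) : FormIndex (Fin 1) (Fin m) → ℂ) ≠ 0 :=
      fun h => by simpa using congrFun h (Sum.inl (0, ⟨0, hm⟩))
    refine ⟨_, (G _).2, fun h => ?_, (hrk _ hne).2 ⟨hne, _, _, _, rfl⟩⟩
    exact hne (G.map_eq_zero_iff.1 (Subtype.ext h))
  have hcone : cone (Projectivization.map b.equivFun.toLinearMap b.equivFun.injective ''
      minimalRationalTangents m Ω W) =
      (G.trans b.equivFun) '' scrollCone (Fin 1) (Fin m) := by
    ext v
    constructor
    · rintro ⟨hv, p, hp, hpv⟩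
      have hh : (G.trans b.equivFun) ((G.trans b.equivFun).symm v) = v :=
        LinearEquiv.apply_symm_apply _ v
      set h := (G.trans b.equivFun).symm v
      have h0 : h ≠ 0 := fun h0 => hv (by rw [← hh, h0, map_zero])
      have hGh : G h ≠ 0 := by simpa using h0
      have hp' : p = Projectivization.mk ℂ (G h) hGh := by
        refine Projectivization.map_injective _ b.equivFun.injective ?_
        rw [hpv, Projectivization.map_mk]
        congr 1
        exact hh.symm
      rw [hp', mk_mem_minimalRationalTangents_iff hΩ hW hex, hrk h h0] at hp
      exact ⟨h, hp, hh⟩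
    · rintro ⟨h, hh, rfl⟩
      have hGh : G h ≠ 0 := by simpa using hh.1
      have hne : (G.trans b.equivFun) h ≠ 0 := by simpa using hh.1
      refine ⟨hne, Projectivization.mk ℂ (G h) hGh, ?_, Projectivization.map_mk _ _ _ _⟩
      rw [mk_mem_minimalRationalTangents_iff hΩ hW hex, hrk h hh.1]
      exact hh
  refine ⟨G.trans b.equivFun, ?_⟩
  rw [vmrt, zariskiClosure_eq_of_cone_eq _ hcone, hcone]

end Tangent

end ScrollDual

theorem mainTheorem9 :
    (∀ m r : ℕ, r ≤ m →
      ScrollDual.IsIrreducibleHypersurface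
        (ScrollDual.dualVariety (ScrollDual.scroll m (ScrollDual.onesTwo r))) (m + r + 1)) ∧
    (∀ (m : ℕ), 2 ≤ m →
      ∀ Ω : Matrix (Fin (2 * m + 1)) (Fin (2 * m + 1)) ℂ, Ω.transpose = -Ω → Ω.rank = 2 * m →
      ∀ W ∈ ScrollDual.isotropicGrassmannian m Ω, ¬ LinearMap.ker Ω.mulVecLin ≤ W →
      ∀ (d : ℕ) (b : Module.Basis (Fin d) ℂ (ScrollDual.grassmannianTangentSpace Ω W)),
        ScrollDual.IsIrreducibleHypersurface
          (ScrollDual.dualVariety (ScrollDual.vmrt m Ω W b)) (m + 1)) := by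
  refine ⟨fun m r hrm => ScrollDual.isIrreducibleHypersurface_dualVariety_scroll hrm,
    fun m hm Ω hΩ hrank W hW hKW d b => ?_⟩
  obtain ⟨L, hL⟩ := ScrollDual.exists_cone_vmrt_eq (by omega) hΩ hrank hW hKW b
  -- Here `r = 1` and `n = m`, so the condition `r < n` is `m ≥ 2`.
  exact ScrollDual.isIrreducibleHypersurface_of_cone_eq (by omega) L hL
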